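/- Let $K$ be an infinite field, $\Gamma$ a finite quiver, $I$ an admissible ideal of the path algebra $K\Gamma$ and $\Lambda=K\Gamma/I$, with Jacobson radical $J$. (For paths, $qp$ means "$q$ after $p$"; a *right subpath* of $p$ is a path $u$ with $p=u'u$ for some path $u'$.) Suppose that $\Lambda$ has finite uniserial type, i.e. there are only finitely many isomorphism classes of uniserial left $\Lambda$-modules. A *mast* of a uniserial left $\Lambda$-module $U$ of composition length $l+1$ is a path $p$ of length $l$ with $pU\neq 0$; a *top element* of $U$ is an $x\in U\setminus JU$ with $x=ex$ for some vertex $e$. A *detour* on $p$ is a pair $(\alpha,u)$, where $u$ is a right subpath of $p$ and $\alpha$ is an arrow such that $\alpha u$ is a path which is not a right subpath of $p$, while the family $(v_i(\alpha,u))_{i\in I(\alpha,u)}$ of all right subpaths of $p$ that are longer than $u$ and end in the same vertex as $\alpha$ is nonempty. Let $V_p$ be the affine variety of all families $(k_i(\alpha,u))$ of scalars, indexed by the detours $(\alpha,u)$ on $p$ and the $i\in I(\alpha,u)$, for which there are a uniserial left $\Lambda$-module with mast $p$ and a top element $x$ of it such that $\alpha u x=\sum_{i\in I(\alpha,u)}k_i(\alpha,u)\,v_i(\alpha,u)x$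 for every detour $(\alpha,u)$ on $p$. Let $A_p$ be the coordinate ring of $V_p$, i.e. the polynomial ring over $K$ in variables $X_i(\alpha,u)$ modulo the ideal of polynomials vanishing on $V_p$. A detour $(\alpha,u)$ is a *halyard* on $p$ if some $X_i(\alpha,u)$ has nonzero image in $A_p$; the halyard is *slack* if some $X_i(\alpha,u)$ has an image in $A_p$ that is transcendental over $K$. A *graph* of the halyard $(\alpha,u)$ on $p$ is the edge path $p$, drawn downwards with one layer for each vertex passed (starting with layer $0$), together with an edge $\alpha$ from the end of $u$ to the end of some $v_j(\alpha,u)$ such that $\Lambda\alpha u x=\Lambda v_j(\alpha,u)x$ for some uniserial left $\Lambda$-module with mast $p$ and some top element $x$ of it. **Theorem.** Let $p$ be a mast of a uniserial left $\Lambda$-module of composition length $\le 5$. Then every graph of a slack halyard $(\alpha',u)$ on $p$ which does not emerge from the top vertex (i.e. $u$ has positive length) is a subgraph of one of the following graphs, where $1,2,3$ denote distinct vertices: 1. the edge path $1 - 1 - 1 \overset{\alpha}{-} 2 - 3$, together with an edge $\alpha$ from layer $1$ to layer $3$; 2. the edge path $1 - 1 - 1 - 1 \overset{\alpha}{-} 2$,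 together with edges $\alpha$ from layer $1$ to layer $4$ and from layer $2$ to layer $4$; 3. the edge path $1 \overset{\alpha}{-} 2 \overset{\beta}{-} 1 \overset{\alpha}{-} 2 \overset{\gamma}{-} 3$, together with an edge $\gamma$ from layer $1$ to layer $4$. Here the edge path is listed from the top downwards, and the unlabelled edges $1 - 1$ of graphs 1 and 2 all stand for the same loop. The subgraphs include the part $1 - 1 - 1 \overset{\alpha}{-} 2$ of graph 1, with its edge $\alpha$ from layer $1$ to layer $3$, also when no vertex $3$ is available in $\Gamma$. -/

import Mathlib

open Quiver

universe u v w

/-! ### The path algebra of a finite quiver and its quotients -/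

/-- The generators of the path algebra: one for each vertex, one for each arrow. -/
abbrev PathGenerator (V : Type v) [Quiver.{w} V] : Type max v w :=
  V ⊕ (Σ i j : V, (i ⟶ j))

/-- The defining relations of the path algebra of a finite quiver: the vertices are pairwise
orthogonal idempotents with sum `1`, and an arrow `a : i ⟶ j` satisfies `e_j a = a = a e_i`.
So a product `q * p` means "`q` after `p`". -/
inductive PathRel (K : Type u) [Field K] (V : Type v) [Fintype V] [Quiver.{w} V] :
    FreeAlgebra K (PathGenerator V) → FreeAlgebra K (PathGenerator V) → Prop
  | idem (i : V) : PathRel K V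
      (FreeAlgebra.ι K (Sum.inl i) * FreeAlgebra.ι K (Sum.inl i)) (FreeAlgebra.ι K (Sum.inl i))
  | orth (i j : V) (h : i ≠ j) : PathRel K V
      (FreeAlgebra.ι K (Sum.inl i) * FreeAlgebra.ι K (Sum.inl j)) 0
  | one : PathRel K V (∑ i : V, FreeAlgebra.ι K (Sum.inl i)) 1
  | target {i j : V} (a : i ⟶ j) : PathRel K V
      (FreeAlgebra.ι K (Sum.inl j) * FreeAlgebra.ι K (Sum.inr ⟨i, j, a⟩))
      (FreeAlgebra.ι K (Sum.inr ⟨i, j, a⟩))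
  | source {i j : V} (a : i ⟶ j) : PathRel K V
      (FreeAlgebra.ι K (Sum.inr ⟨i, j, a⟩) * FreeAlgebra.ι K (Sum.inl i))
      (FreeAlgebra.ι K (Sum.inr ⟨i, j, a⟩))

/-- The path algebra `KΓ` of the finite quiver `Γ` with vertex set `V`. -/
abbrev PathAlgebra (K : Type u) [Field K] (V : Type v) [Fintype V] [Quiver.{w} V] :
    Type max u v w :=
  RingQuot (PathRel K V)

section PathAlgebra

variable (K : Type u) [Field K] {V : Type v} [Fintype V] [Quiver.{w} V]

/-- The idempotent of `KΓ` attached to a vertex. -/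
noncomputable def vertexElt (i : V) : PathAlgebra K V :=
  RingQuot.mkAlgHom K (PathRel K V) (FreeAlgebra.ι K (Sum.inl i))

/-- The element of `KΓ` given by an arrow. -/
noncomputable def arrowElt {i j : V} (a : i ⟶ j) : PathAlgebra K V :=
  RingQuot.mkAlgHom K (PathRel K V) (FreeAlgebra.ι K (Sum.inr ⟨i, j, a⟩))

/-- The element of `KΓ` given by a path; a path of length zero gives the idempotent of its vertex,
and the arrow travelled last is the leftmost factor. -/
noncomputable def pathElt {i : V} : {j : V} → Path i j → PathAlgebra K V
  | _, Path.nil => vertexElt K i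
  | _, Path.cons p a => arrowElt K a * pathElt p

end PathAlgebra

section Modules

variable {K : Type u} [Field K] {V : Type v} [Fintype V] [Quiver.{w} V]

/-- The ideal `I` is admissible: each element of `I` is a linear combination of paths of length at
least two, and all sufficiently long paths belong to `I`. -/
def IsAdmissible (I : Ideal (PathAlgebra K V)) : Prop :=
  (∀ r ∈ I, r ∈ Submodule.span K
    {x : PathAlgebra K V | ∃ (i j : V) (p : Path i j), 2 ≤ p.length ∧ pathElt K p = x}) ∧
  ∃ n : ℕ, ∀ (i j : V) (p : Path i j), n ≤ p.length → pathElt K p ∈ I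

/-- A uniserial module: a nonzero finitely generated module whose submodules form a chain. -/
structure IsUniserial (R : Type*) [Ring R] (M : Type*) [AddCommGroup M] [Module R M] : Prop where
  finite : Module.Finite R M
  nontrivial : Nontrivial M
  chain : ∀ N P : Submodule R M, N ≤ P ∨ P ≤ N

variable (I : Ideal (PathAlgebra K V)) [I.IsTwoSided]

/-- The algebra `Λ = KΓ/I` has finite uniserial type: its uniserial left modules fall into finitely
many isomorphism classes. -/
def FiniteUniserialType : Prop :=
  ∃ (n : ℕ) (M : Fin n → ModuleCat.{max u v w} (PathAlgebra K V ⧸ I)),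
    ∀ (U : Type max u v w) [AddCommGroup U] [Module (PathAlgebra K V ⧸ I) U],
      IsUniserial (PathAlgebra K V ⧸ I) U →
        ∃ i, Nonempty (U ≃ₗ[PathAlgebra K V ⧸ I] M i)

/-- The action of an element of `KΓ` on an element of a left `KΓ/I`-module. -/
noncomputable def act {U : Type*} [AddCommGroup U] [Module (PathAlgebra K V ⧸ I) U]
    (r : PathAlgebra K V) (x : U) : U :=
  Ideal.Quotient.mk I r • x

/-- `p` is a mast of the uniserial module `U`: if `p` has length `l`, then `U` has composition
length `l + 1` and `pU ≠ 0`. -/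
def IsMastOf (U : Type*) [AddCommGroup U] [Module (PathAlgebra K V ⧸ I) U]
    {a b : V} (p : Path a b) : Prop :=
  IsUniserial (PathAlgebra K V ⧸ I) U ∧
    Module.length (PathAlgebra K V ⧸ I) U = p.length + 1 ∧
    ∃ m : U, act I (pathElt K p) m ≠ 0

/-- `x` is a top element of `U`: it lies outside `JU`, with `J` the Jacobson radical, and `x = ex`
for some vertex `e`. -/
def IsTopElement {U : Type*} [AddCommGroup U] [Module (PathAlgebra K V ⧸ I) U] (x : U) : Prop :=
  x ∉ Ring.jacobson (PathAlgebra K V ⧸ I) • (⊤ : Submodule (PathAlgebra K V ⧸ I) U) ∧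
    ∃ e : V, act I (vertexElt K e) x = x

end Modules

/-! ### Detours -/

section Detours

variable {V : Type v} [Quiver.{w} V]

/-- `u` is a right subpath (an initial piece) of `p`, i.e. `p = u'u`, "`u'` after `u`". -/
def IsRightSubpath {a b c : V} (u : Path a c) (p : Path a b) : Prop :=
  ∃ u' : Path c b, p = u.comp u'

/-- A detour `(α, u)` on `p`: here `u` is a right subpath of `p` and `α` an arrow starting where `u`
ends, such that `αu` is not a right subpath of `p`, but some right subpath of `p` strictly longer
than `u` ends in the same vertex as `α`. -/
structure Detour {a b : V} (p : Path a b) where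
  {c : V}
  {d : V}
  u : Path a c
  α : c ⟶ d
  right : IsRightSubpath u p
  notRight : ¬ IsRightSubpath (u.cons α) p
  longer : ∃ v : Path a d, IsRightSubpath v p ∧ u.length < v.length

/-- The family `(v_i(α,u))` attached to a detour `(α,u)` on `p`: all right subpaths of `p` that are
longer than `u` and end in the same vertex as `α`. -/
def Detour.family {a b : V} {p : Path a b} (δ : Detour p) : Set (Path a δ.d) :=
  {v | IsRightSubpath v p ∧ δ.u.length < v.length}

/-- This family is finite; so the sums over it below are genuine finite sums. -/
theorem Detour.family_finite {a b : V} {p : Path a b} (δ : Detour p) : δ.family.Finite := by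
  apply Set.Finite.of_injOn (f := fun v : Path a δ.d => v.length) (t := Set.Iic p.length)
  · rintro v ⟨⟨v', hv'⟩, -⟩
    simp [hv', Path.length_comp]
  · rintro v ⟨⟨v', hv'⟩, -⟩ w ⟨⟨w', hw'⟩, -⟩ h
    exact ((Path.comp_inj' h).1 (hv'.symm.trans hw')).1
  · exact Set.finite_Iic _

/-- The index set of the variables `X_i(α,u)`: one for each detour `(α,u)` on `p` and each member
`v_i(α,u)` of its family. -/
abbrev DetourVar {a b : V} (p : Path a b) : Type max v w :=
  Σ δ : Detour p, δ.family

end Detours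

/-! ### The uniserial variety of a path; halyards -/

section Halyards

variable {K : Type u} [Field K] {V : Type v} [Fintype V] [Quiver.{w} V]
variable (I : Ideal (PathAlgebra K V)) [I.IsTwoSided]

/-- The affine variety `V_p`: the points whose coordinates `k_i(α,u)` are the coefficients in the
equations `αu x = ∑ k_i(α,u) v_i(α,u) x`, one for each detour `(α,u)` on `p`, of some uniserial left
`KΓ/I`-module with mast `p` relative to a top element `x`. -/
def uniserialVariety {a b : V} (p : Path a b) : Set (DetourVar p → K) :=
  {k | ∃ (U : Type max u v w) (_ : AddCommGroup U) (_ : Module (PathAlgebra K V ⧸ I) U),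
    IsMastOf I U p ∧ ∃ x : U, IsTopElement I x ∧
      ∀ δ : Detour p, act I (pathElt K (δ.u.cons δ.α)) x =
        ∑ᶠ v : δ.family, act I (algebraMap K (PathAlgebra K V) (k ⟨δ, v⟩) * pathElt K v.1) x}

/-- The coordinate ring `A_p` of `V_p`: the polynomial ring in the variables `X_i(α,u)` modulo the
polynomials vanishing on `V_p`. -/
abbrev UniserialCoordinateRing {a b : V} (p : Path a b) : Type max u v w :=
  MvPolynomial (DetourVar p) K ⧸ MvPolynomial.vanishingIdeal K (uniserialVariety I p)

/-- The image in `A_p` of the variable `X_i(α,u)`. -/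
noncomputable def coordVar {a b : V} {p : Path a b} (δ : Detour p) (v : δ.family) :
    UniserialCoordinateRing I p :=
  Ideal.Quotient.mk _ (MvPolynomial.X ⟨δ, v⟩)

/-- The detour `(α,u)` is a halyard on `p`: one of its variables has nonzero image in `A_p`. -/
def IsHalyard {a b : V} {p : Path a b} (δ : Detour p) : Prop :=
  ∃ v : δ.family, coordVar I δ v ≠ 0

/-- A slack halyard: a halyard with at least one slack variable, i.e. a variable whose image in
`A_p` is transcendental over `K`. -/
def IsSlackHalyard {a b : V} {p : Path a b} (δ : Detour p) : Prop :=
  IsHalyard I δ ∧ ∃ v : δ.family, Transcendental K (coordVar I δ v)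

/-- The halyard `(α,u)` on `p` has a graph whose additional edge `α` runs from the end of `u` down
to the end of `v = v_j(α,u)`: in some uniserial module with mast `p` and top element `x`, one has
`Λαux = Λvx`. -/
def HasGraphAt {a b : V} {p : Path a b} (δ : Detour p) (v : δ.family) : Prop :=
  ∃ (U : Type max u v w) (_ : AddCommGroup U) (_ : Module (PathAlgebra K V ⧸ I) U),
    IsMastOf I U p ∧ ∃ x : U, IsTopElement I x ∧
      Submodule.span (PathAlgebra K V ⧸ I) {act I (pathElt K (δ.u.cons δ.α)) x} =
        Submodule.span (PathAlgebra K V ⧸ I) {act I (pathElt K v.1) x}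

end Halyards

/-! ### Layered labelled graphs -/

section Graphs

variable (V : Type v) [Quiver.{w} V]

/-- A layered graph, with nodes labelled by vertices and edges labelled by arrows of the quiver:
`(n, e)` in `nodes` is a node labelled `e` in layer `n` (the top layer is layer `0`), and
`(m, n, α)` in `edges` is an edge labelled `α` leading from layer `m` down to layer `n`. -/
@[ext] structure LayeredGraph where
  nodes : Set (ℕ × V)
  edges : Set (ℕ × ℕ × (Σ i j : V, (i ⟶ j)))

variable {V}

/-- `G.IsSubgraph H`: every node and every edge of `G` is one of `H`. -/
def LayeredGraph.IsSubgraph (G H : LayeredGraph V) : Prop :=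
  G.nodes ⊆ H.nodes ∧ G.edges ⊆ H.edges

/-- The graph of a halyard `(α,u)` on `p`: the edge path `p`, running from the top downwards one
layer at a time, together with an edge `α` from the end of `u` to the end of `v`. -/
def halyardGraph {a b : V} {p : Path a b} (δ : Detour p) (v : δ.family) : LayeredGraph V where
  nodes := {x | ∃ (c : V) (q : Path a c), IsRightSubpath q p ∧ x = (q.length, c)}
  edges := insert (δ.u.length, v.1.length, ⟨δ.c, δ.d, δ.α⟩)
    {x | ∃ (c d : V) (q : Path a c) (β : c ⟶ d), IsRightSubpath (q.cons β) p ∧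
      x = (q.length, q.length + 1, ⟨c, d, β⟩)}

/-- The edge path `1 - 1 - 1 - 2` with last edge `α`, and an edge `α` from layer 1 to layer 3. -/
def shapeLoopTwoShort {e₁ e₂ : V} (l : e₁ ⟶ e₁) (α : e₁ ⟶ e₂) : LayeredGraph V where
  nodes := {(0, e₁), (1, e₁), (2, e₁), (3, e₂)}
  edges := {(0, 1, ⟨e₁, e₁, l⟩), (1, 2, ⟨e₁, e₁, l⟩), (2, 3, ⟨e₁, e₂, α⟩),
    (1, 3, ⟨e₁, e₂, α⟩)}

/-- The edge path `1 - 1 - 1 - 2 - 3` with third edge `α`, and an edge `α` from layer 1 to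
layer 3. -/
def shapeLoopTwo {e₁ e₂ e₃ : V} (l : e₁ ⟶ e₁) (α : e₁ ⟶ e₂) (β : e₂ ⟶ e₃) : LayeredGraph V where
  nodes := {(0, e₁), (1, e₁), (2, e₁), (3, e₂), (4, e₃)}
  edges := {(0, 1, ⟨e₁, e₁, l⟩), (1, 2, ⟨e₁, e₁, l⟩), (2, 3, ⟨e₁, e₂, α⟩), (3, 4, ⟨e₂, e₃, β⟩),
    (1, 3, ⟨e₁, e₂, α⟩)}

/-- The edge path `1 - 1 - 1 - 1 - 2` with last edge `α`, and edges `α` from layer 1 to layer 4 and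
from layer 2 to layer 4. -/
def shapeLoopThree {e₁ e₂ : V} (l : e₁ ⟶ e₁) (α : e₁ ⟶ e₂) : LayeredGraph V where
  nodes := {(0, e₁), (1, e₁), (2, e₁), (3, e₁), (4, e₂)}
  edges := {(0, 1, ⟨e₁, e₁, l⟩), (1, 2, ⟨e₁, e₁, l⟩), (2, 3, ⟨e₁, e₁, l⟩), (3, 4, ⟨e₁, e₂, α⟩),
    (1, 4, ⟨e₁, e₂, α⟩), (2, 4, ⟨e₁, e₂, α⟩)}

/-- The edge path `1 - 2 - 1 - 2 - 3` with edges `α, β, α, γ`, and an edge `γ` from layer 1 to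
layer 4. -/
def shapeTwoCycle {e₁ e₂ e₃ : V} (α : e₁ ⟶ e₂) (β : e₂ ⟶ e₁) (γ : e₂ ⟶ e₃) : LayeredGraph V where
  nodes := {(0, e₁), (1, e₂), (2, e₁), (3, e₂), (4, e₃)}
  edges := {(0, 1, ⟨e₁, e₂, α⟩), (1, 2, ⟨e₂, e₁, β⟩), (2, 3, ⟨e₁, e₂, α⟩), (3, 4, ⟨e₂, e₃, γ⟩),
    (1, 4, ⟨e₂, e₃, γ⟩)}

/-- The admissible shapes. The first one is the part above the bottom node of the second one; it is
listed separately because the quiver need not contain an arrow that the bottom edge could carry. -/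
def IsListedShape (H : LayeredGraph V) : Prop :=
  (∃ (e₁ e₂ : V) (l : e₁ ⟶ e₁) (α : e₁ ⟶ e₂), e₁ ≠ e₂ ∧ H = shapeLoopTwoShort l α) ∨
  (∃ (e₁ e₂ e₃ : V) (l : e₁ ⟶ e₁) (α : e₁ ⟶ e₂) (β : e₂ ⟶ e₃),
    e₁ ≠ e₂ ∧ e₁ ≠ e₃ ∧ e₂ ≠ e₃ ∧ H = shapeLoopTwo l α β) ∨
  (∃ (e₁ e₂ : V) (l : e₁ ⟶ e₁) (α : e₁ ⟶ e₂), e₁ ≠ e₂ ∧ H = shapeLoopThree l α) ∨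
  (∃ (e₁ e₂ e₃ : V) (α : e₁ ⟶ e₂) (β : e₂ ⟶ e₁) (γ : e₂ ⟶ e₃),
    e₁ ≠ e₂ ∧ e₁ ≠ e₃ ∧ e₂ ≠ e₃ ∧ H = shapeTwoCycle α β γ)

end Graphs

universe x

/-! ### Products of paths in the path algebra -/

section PathProducts

variable (K : Type u) [Field K] {V : Type v} [Fintype V] [Quiver.{w} V]

theorem vertexElt_mul_self (i : V) :
    (vertexElt K i : PathAlgebra K V) * vertexElt K i = vertexElt K i := by
  simpa [vertexElt] using RingQuot.mkAlgHom_rel K (PathRel.idem (K := K) i)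

theorem vertexElt_mul_of_ne {i j : V} (h : i ≠ j) :
    (vertexElt K i : PathAlgebra K V) * vertexElt K j = 0 := by
  simpa [vertexElt] using RingQuot.mkAlgHom_rel K (PathRel.orth (K := K) i j h)

theorem sum_vertexElt : ∑ i : V, (vertexElt K i : PathAlgebra K V) = 1 := by
  simpa [vertexElt] using RingQuot.mkAlgHom_rel K (PathRel.one (K := K) (V := V))

theorem vertexElt_mul_arrowElt {i j : V} (a : i ⟶ j) :
    vertexElt K j * arrowElt K a = arrowElt K a := by
  simpa [vertexElt, arrowElt] using RingQuot.mkAlgHom_rel K (PathRel.target (K := K) a)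

theorem arrowElt_mul_vertexElt {i j : V} (a : i ⟶ j) :
    arrowElt K a * vertexElt K i = arrowElt K a := by
  simpa [vertexElt, arrowElt] using RingQuot.mkAlgHom_rel K (PathRel.source (K := K) a)

@[simp] theorem pathElt_nil (i : V) : pathElt K (Path.nil : Path i i) = vertexElt K i := rfl

@[simp] theorem pathElt_cons {i j k : V} (p : Path i j) (a : j ⟶ k) :
    pathElt K (p.cons a) = arrowElt K a * pathElt K p := rfl

theorem pathElt_mul_vertexElt {i j : V} (p : Path i j) :
    pathElt K p * vertexElt K i = pathElt K p := by
  induction p with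
  | nil => exact vertexElt_mul_self K i
  | cons p a ih => rw [pathElt_cons, mul_assoc, ih]

theorem vertexElt_mul_pathElt {i j : V} (p : Path i j) :
    vertexElt K j * pathElt K p = pathElt K p := by
  cases p with
  | nil => exact vertexElt_mul_self K i
  | cons p a => rw [pathElt_cons, ← mul_assoc, vertexElt_mul_arrowElt]

theorem pathElt_single {i j : V} (a : i ⟶ j) :
    pathElt K ((Path.nil : Path i i).cons a) = arrowElt K a :=
  arrowElt_mul_vertexElt K a

theorem pathElt_comp {i j k : V} (p : Path i j) (q : Path j k) :
    pathElt K (p.comp q) = pathElt K q * pathElt K p := by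
  induction q with
  | nil => exact (vertexElt_mul_pathElt K p).symm
  | cons q a ih => rw [Path.comp_cons, pathElt_cons, pathElt_cons, ih, mul_assoc]

theorem pathElt_mul_of_ne {i j k l : V} (p : Path i j) (q : Path k l) (h : k ≠ j) :
    pathElt K q * pathElt K p = 0 := by
  rw [← pathElt_mul_vertexElt K q, ← vertexElt_mul_pathElt K p, mul_assoc,
    ← mul_assoc (vertexElt K k), vertexElt_mul_of_ne K h, zero_mul, mul_zero]

variable (V)

/-- The span of the paths of length at least `n`. -/
def pathSpan (n : ℕ) : Submodule K (PathAlgebra K V) :=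
  Submodule.span K {x | ∃ (i j : V) (p : Path i j), n ≤ p.length ∧ pathElt K p = x}

variable {V}

theorem pathElt_mem_pathSpan {i j : V} (p : Path i j) {n : ℕ} (h : n ≤ p.length) :
    pathElt K p ∈ pathSpan K V n :=
  Submodule.subset_span ⟨i, j, p, h, rfl⟩

variable {K}

theorem pathSpan_induction {n : ℕ} {P : PathAlgebra K V → Prop}
    (path : ∀ (i j : V) (p : Path i j), n ≤ p.length → P (pathElt K p)) (zero : P 0)
    (add : ∀ x y, P x → P y → P (x + y)) (smul : ∀ (k : K) x, P x → P (k • x))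
    {r : PathAlgebra K V} (hr : r ∈ pathSpan K V n) : P r := by
  refine Submodule.span_induction (p := fun r _ => P r) ?_ zero (fun x y _ _ => add x y)
    (fun k x _ => smul k x) hr
  rintro _ ⟨i, j, p, hp, rfl⟩
  exact path i j p hp

theorem pathSpan_anti {m n : ℕ} (h : m ≤ n) : pathSpan K V n ≤ pathSpan K V m := by
  intro r hr
  exact pathSpan_induction (P := (· ∈ pathSpan K V m))
    (fun i j p hp => pathElt_mem_pathSpan K p (h.trans hp)) (zero_mem _)
    (fun _ _ => add_mem) (fun k _ => Submodule.smul_mem _ k) hr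

theorem pathElt_mul_pathElt_mem {i j k l : V} (q : Path k l) (p : Path i j) :
    pathElt K q * pathElt K p ∈ pathSpan K V (q.length + p.length) := by
  by_cases h : k = j
  · subst h
    rw [← pathElt_comp]
    exact pathElt_mem_pathSpan K _ (by rw [Path.length_comp]; omega)
  · rw [pathElt_mul_of_ne K p q h]
    exact zero_mem _

theorem mul_mem_pathSpan {m n : ℕ} {r s : PathAlgebra K V} (hr : r ∈ pathSpan K V m)
    (hs : s ∈ pathSpan K V n) : r * s ∈ pathSpan K V (m + n) := by
  refine pathSpan_induction (P := fun r => r * s ∈ pathSpan K V (m + n)) ?_ ?_ ?_ ?_ hr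
  · intro k l q hq
    refine pathSpan_induction (P := fun s => pathElt K q * s ∈ pathSpan K V (m + n)) ?_ ?_ ?_ ?_ hs
    · intro i j p hp
      exact pathSpan_anti (by omega) (pathElt_mul_pathElt_mem q p)
    · rw [mul_zero]; exact zero_mem _
    · intro x y hx hy
      rw [mul_add]; exact add_mem hx hy
    · intro c x hx
      rw [mul_smul_comm]; exact Submodule.smul_mem _ c hx
  · rw [zero_mul]; exact zero_mem _
  · intro x y hx hy
    rw [add_mul]; exact add_mem hx hy
  · intro c x hx
    rw [smul_mul_assoc]; exact Submodule.smul_mem _ c hx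

theorem one_mem_pathSpan : (1 : PathAlgebra K V) ∈ pathSpan K V 0 := by
  rw [← sum_vertexElt]
  exact Submodule.sum_mem _ fun i _ => pathElt_mem_pathSpan K (Path.nil : Path i i) (Nat.zero_le _)

theorem arrowElt_mem_pathSpan {i j : V} (a : i ⟶ j) : arrowElt K a ∈ pathSpan K V 1 := by
  rw [← pathElt_single]
  exact pathElt_mem_pathSpan K _ le_rfl

theorem mem_pathSpan_zero (r : PathAlgebra K V) : r ∈ pathSpan K V 0 := by
  obtain ⟨r, rfl⟩ := RingQuot.mkAlgHom_surjective K (PathRel K V) r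
  induction r using FreeAlgebra.induction with
  | grade0 k =>
    have h : RingQuot.mkAlgHom K (PathRel K V) (algebraMap K _ k) =
        k • (1 : PathAlgebra K V) := by
      rw [AlgHom.commutes, Algebra.algebraMap_eq_smul_one]
    rw [h]
    exact Submodule.smul_mem _ k one_mem_pathSpan
  | grade1 g =>
    rcases g with i | ⟨i, j, a⟩
    · exact pathElt_mem_pathSpan K (Path.nil : Path i i) (Nat.zero_le _)
    · exact pathSpan_anti (Nat.zero_le _) (arrowElt_mem_pathSpan a)
  | mul x y hx hy =>
    rw [map_mul]
    exact pathSpan_anti (Nat.zero_le _) (mul_mem_pathSpan hx hy)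
  | add x y hx hy =>
    rw [map_add]
    exact add_mem hx hy

theorem path_induction {P : PathAlgebra K V → Prop}
    (path : ∀ (i j : V) (p : Path i j), P (pathElt K p)) (zero : P 0)
    (add : ∀ x y, P x → P y → P (x + y)) (smul : ∀ (k : K) x, P x → P (k • x))
    (r : PathAlgebra K V) : P r :=
  pathSpan_induction (fun i j p _ => path i j p) zero add smul (mem_pathSpan_zero r)

end PathProducts

/-! ### The endomorphism adding a multiple of a path to a parallel arrow -/

section Shear

variable {K : Type u} [Field K] {V : Type v} [Fintype V] [Quiver.{w} V]

open Classical in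
/-- The images of the generators under the shear `α ↦ α + k q`. -/
noncomputable def shearGenerator {c d : V} (α : c ⟶ d) (q : Path c d) (k : K) :
    PathGenerator V → PathAlgebra K V
  | Sum.inl i => vertexElt K i
  | Sum.inr g => arrowElt K g.2.2 +
      if g = (⟨c, d, α⟩ : Σ i j : V, (i ⟶ j)) then k • pathElt K q else 0

/-- The endomorphism of the path algebra fixing all vertices and all arrows except `α`, which is
sent to `α + k q`. -/
noncomputable def shear {c d : V} (α : c ⟶ d) (q : Path c d) (k : K) :
    PathAlgebra K V →ₐ[K] PathAlgebra K V :=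
  RingQuot.liftAlgHom K ⟨FreeAlgebra.lift K (shearGenerator α q k), by
    intro x y h
    induction h with
    | idem i => simp [shearGenerator, vertexElt_mul_self]
    | orth i j h => simp [shearGenerator, vertexElt_mul_of_ne K h]
    | one => simp [shearGenerator, sum_vertexElt]
    | target a =>
      simp only [map_mul, FreeAlgebra.lift_ι_apply, shearGenerator, mul_add,
        vertexElt_mul_arrowElt]
      split_ifs with h
      · cases h
        rw [mul_smul_comm, vertexElt_mul_pathElt]
      · rw [mul_zero]
    | source a =>
      simp only [map_mul, FreeAlgebra.lift_ι_apply, shearGenerator, add_mul,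
        arrowElt_mul_vertexElt]
      split_ifs with h
      · cases h
        rw [smul_mul_assoc, pathElt_mul_vertexElt]
      · rw [zero_mul]⟩

variable {c d : V} (α : c ⟶ d) (q : Path c d) (k : K)

@[simp] theorem shear_vertexElt (i : V) : shear α q k (vertexElt K i) = vertexElt K i := by
  simp [shear, vertexElt, shearGenerator]

theorem shear_arrowElt_self : shear α q k (arrowElt K α) = arrowElt K α + k • pathElt K q := by
  simp [shear, arrowElt, shearGenerator]

theorem shear_arrowElt_of_ne {i j : V} (a : i ⟶ j)
    (h : (⟨i, j, a⟩ : Σ i j : V, (i ⟶ j)) ≠ ⟨c, d, α⟩) :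
    shear α q k (arrowElt K a) = arrowElt K a := by
  simp [shear, arrowElt, shearGenerator, h]

theorem shear_arrowElt_sub_mem {i j : V} (a : i ⟶ j) :
    shear α q k (arrowElt K a) - arrowElt K a ∈ pathSpan K V q.length := by
  by_cases h : (⟨i, j, a⟩ : Σ i j : V, (i ⟶ j)) = ⟨c, d, α⟩
  · cases h
    rw [shear_arrowElt_self, add_sub_cancel_left]
    exact Submodule.smul_mem _ k (pathElt_mem_pathSpan K q le_rfl)
  · rw [shear_arrowElt_of_ne α q k a h, sub_self]
    exact zero_mem _

theorem shear_pathElt_sub_mem (hq : 1 ≤ q.length) {i j : V} (y : Path i j) :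
    shear α q k (pathElt K y) - pathElt K y ∈ pathSpan K V (y.length + q.length - 1) := by
  induction y with
  | nil => rw [pathElt_nil, shear_vertexElt, sub_self]; exact zero_mem _
  | cons y a ih =>
    have e : shear α q k (pathElt K (y.cons a)) - pathElt K (y.cons a) =
        (shear α q k (arrowElt K a) - arrowElt K a) * pathElt K y +
        (shear α q k (arrowElt K a) - arrowElt K a) *
          (shear α q k (pathElt K y) - pathElt K y) +
        arrowElt K a * (shear α q k (pathElt K y) - pathElt K y) := by
      rw [pathElt_cons, map_mul]
      simp only [mul_sub, sub_mul]
      abel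
    have h := shear_arrowElt_sub_mem α q k a
    rw [e, Path.length_cons]
    refine add_mem (add_mem ?_ ?_) ?_
    · exact pathSpan_anti (by omega) (mul_mem_pathSpan h (pathElt_mem_pathSpan K y le_rfl))
    · exact pathSpan_anti (by omega) (mul_mem_pathSpan h ih)
    · exact pathSpan_anti (by omega) (mul_mem_pathSpan (arrowElt_mem_pathSpan a) ih)

theorem shear_sub_mem (hq : 1 ≤ q.length) {n : ℕ} {r : PathAlgebra K V}
    (hr : r ∈ pathSpan K V n) : shear α q k r - r ∈ pathSpan K V (n + q.length - 1) := by
  refine pathSpan_induction (P := fun r => shear α q k r - r ∈ pathSpan K V (n + q.length - 1))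
    ?_ ?_ ?_ ?_ hr
  · intro i j p hp
    exact pathSpan_anti (by omega) (shear_pathElt_sub_mem α q k hq p)
  · rw [map_zero, sub_zero]; exact zero_mem _
  · intro x y hx hy
    rw [map_add, add_sub_add_comm]; exact add_mem hx hy
  · intro c x hx
    have e : shear α q k (c • x) - c • x = c • (shear α q k x - x) := by
      rw [map_smul, Algebra.smul_def, Algebra.smul_def, Algebra.smul_def, mul_sub]
    rw [e]; exact Submodule.smul_mem _ c hx

end Shear

/-! ### The filtration of a module by path length -/

section PathFiltration

variable {K : Type u} [Field K] {V : Type v} [Fintype V] [Quiver.{w} V]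

variable (K V) in
/-- The submodule generated by the images of the paths of length at least `n`. -/
def pathFiltration (M : Type x) [AddCommGroup M] [Module (PathAlgebra K V) M] (n : ℕ) :
    Submodule (PathAlgebra K V) M :=
  Submodule.span (PathAlgebra K V) {m | ∃ r ∈ pathSpan K V n, ∃ m' : M, r • m' = m}

variable {M : Type x} [AddCommGroup M] [Module (PathAlgebra K V) M]

theorem smul_mem_pathFiltration {n : ℕ} {r : PathAlgebra K V} (hr : r ∈ pathSpan K V n) (m : M) :
    r • m ∈ pathFiltration K V M n :=
  Submodule.subset_span ⟨r, hr, m, rfl⟩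

theorem mem_pathFiltration_zero (m : M) : m ∈ pathFiltration K V M 0 := by
  simpa using smul_mem_pathFiltration (mem_pathSpan_zero (1 : PathAlgebra K V)) m

theorem pathFiltration_anti {m n : ℕ} (h : m ≤ n) :
    pathFiltration K V M n ≤ pathFiltration K V M m := by
  refine Submodule.span_mono ?_
  rintro _ ⟨r, hr, m', rfl⟩
  exact ⟨r, pathSpan_anti h hr, m', rfl⟩

theorem smul_mem_pathFiltration_add {i j : ℕ} {r : PathAlgebra K V} (hr : r ∈ pathSpan K V i)
    {m : M} (hm : m ∈ pathFiltration K V M j) : r • m ∈ pathFiltration K V M (i + j) := by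
  revert r
  refine Submodule.span_induction (p := fun m _ => ∀ {r : PathAlgebra K V}, r ∈ pathSpan K V i →
    r • m ∈ pathFiltration K V M (i + j)) ?_ ?_ ?_ ?_ hm
  · rintro _ ⟨s, hs, m', rfl⟩ r hr
    rw [smul_smul]
    exact smul_mem_pathFiltration (mul_mem_pathSpan hr hs) m'
  · intro r _
    rw [smul_zero]; exact zero_mem _
  · intro m m' _ _ h h' r hr
    rw [smul_add]; exact add_mem (h hr) (h' hr)
  · intro s m _ h r hr
    rw [smul_smul]
    exact h (pathSpan_anti (by omega) (mul_mem_pathSpan hr (mem_pathSpan_zero s)))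

theorem pathFiltration_eq_bot {n : ℕ}
    (h : ∀ r ∈ pathSpan K V n, ∀ m : M, r • m = 0) : pathFiltration K V M n = ⊥ := by
  refine Submodule.span_eq_bot.2 ?_
  rintro _ ⟨r, hr, m, rfl⟩
  exact h r hr m

theorem pathFiltration_succ_le {n : ℕ}
    (h : pathFiltration K V M n ≤ pathFiltration K V M (n + 1)) :
    pathFiltration K V M (n + 1) ≤ pathFiltration K V M (n + 2) := by
  refine Submodule.span_le.2 ?_
  rintro _ ⟨r, hr, m, rfl⟩
  refine pathSpan_induction (P := fun r => r • m ∈ pathFiltration K V M (n + 2)) ?_ ?_ ?_ ?_ hr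
  · intro i j p hp
    cases p with
    | nil => simp at hp
    | cons p a =>
      rw [pathElt_cons, mul_smul]
      have hp' : n ≤ p.length := by simpa using hp
      exact pathFiltration_anti (by omega) (smul_mem_pathFiltration_add (arrowElt_mem_pathSpan a)
        (h (smul_mem_pathFiltration (pathElt_mem_pathSpan K p hp') m)))
  · rw [zero_smul]; exact zero_mem _
  · intro r s hr hs
    rw [add_smul]; exact add_mem hr hs
  · intro k r hr
    rw [Algebra.smul_def, mul_smul]; exact Submodule.smul_mem _ _ hr

theorem pathFiltration_le_of_stable {n : ℕ}
    (h : pathFiltration K V M n ≤ pathFiltration K V M (n + 1)) (k : ℕ) :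
    pathFiltration K V M n ≤ pathFiltration K V M (n + k) := by
  have step : ∀ k, pathFiltration K V M (n + k) ≤ pathFiltration K V M (n + k + 1) := by
    intro k
    induction k with
    | zero => exact h
    | succ k ih => exact pathFiltration_succ_le ih
  induction k with
  | zero => exact le_rfl
  | succ k ih => exact ih.trans (step k)

variable [Module K M] [IsScalarTower K (PathAlgebra K V) M]

/-- On a homogeneous element of the `n`-th layer, the path algebra acts by scalars modulo the next
layer. -/
theorem exists_smul_sub_mem {n : ℕ} {j : V} {z : M} (hz : z ∈ pathFiltration K V M n)
    (hj : vertexElt K j • z = z) (r : PathAlgebra K V) :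
    ∃ c : K, r • z - c • z ∈ pathFiltration K V M (n + 1) := by
  refine path_induction (P := fun r => ∃ c : K, r • z - c • z ∈ pathFiltration K V M (n + 1))
    ?_ ?_ ?_ ?_ r
  · intro i k p
    cases p with
    | nil =>
      by_cases h : i = j
      · subst h
        exact ⟨1, by rw [pathElt_nil, hj, one_smul, sub_self]; exact zero_mem _⟩
      · refine ⟨0, ?_⟩
        rw [pathElt_nil, ← hj, smul_smul, vertexElt_mul_of_ne K h, zero_smul, zero_smul, sub_self]
        exact zero_mem _
    | cons p a =>
      refine ⟨0, ?_⟩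
      rw [zero_smul, sub_zero, add_comm]
      exact smul_mem_pathFiltration_add (pathElt_mem_pathSpan K (p.cons a) (by simp)) hz
  · exact ⟨0, by rw [zero_smul, zero_smul, sub_self]; exact zero_mem _⟩
  · rintro r s ⟨c, hc⟩ ⟨d, hd⟩
    exact ⟨c + d, by rw [add_smul, add_smul, add_sub_add_comm]; exact add_mem hc hd⟩
  · rintro k r ⟨c, hc⟩
    refine ⟨k * c, ?_⟩
    rw [smul_assoc, mul_smul, ← smul_sub]
    exact Submodule.smul_of_tower_mem _ k hc

theorem vertexElt_smul_smul_mem {n : ℕ} {j : V} {z : M} (hz : z ∈ pathFiltration K V M n)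
    (hj : vertexElt K j • z = 0) (r : PathAlgebra K V) :
    vertexElt K j • r • z ∈ pathFiltration K V M (n + 1) := by
  refine path_induction (P := fun r => vertexElt K j • r • z ∈ pathFiltration K V M (n + 1))
    ?_ ?_ ?_ ?_ r
  · intro i k p
    cases p with
    | nil =>
      by_cases h : j = i
      · subst h
        rw [pathElt_nil, hj, smul_zero]; exact zero_mem _
      · rw [pathElt_nil, smul_smul, vertexElt_mul_of_ne K h, zero_smul]; exact zero_mem _
    | cons p a =>
      refine Submodule.smul_mem _ _ ?_
      rw [add_comm]
      exact smul_mem_pathFiltration_add (pathElt_mem_pathSpan K (p.cons a) (by simp)) hz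
  · rw [zero_smul, smul_zero]; exact zero_mem _
  · intro r s hr hs
    rw [add_smul, smul_add]; exact add_mem hr hs
  · intro k r hr
    rw [smul_assoc, smul_comm]; exact Submodule.smul_of_tower_mem _ k hr

theorem mem_of_smul_mem_tower {S : Submodule (PathAlgebra K V) M} {c : K} {m : M} (hc : c ≠ 0)
    (h : c • m ∈ S) : m ∈ S := by
  have := Submodule.smul_of_tower_mem S c⁻¹ h
  rwa [smul_smul, inv_mul_cancel₀ hc, one_smul] at this

theorem exists_mem_span_singleton_of_chain {R N : Type*} [Ring R] [AddCommGroup N] [Module R N]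
    (chain : ∀ S T : Submodule R N, S ≤ T ∨ T ≤ S) (F : Submodule R N) (y z : N) :
    (∃ r : R, y - r • z ∈ F) ∨ ∃ r : R, z - r • y ∈ F := by
  have key : ∀ y z : N, R ∙ y ⊔ F ≤ R ∙ z ⊔ F → ∃ r : R, y - r • z ∈ F := by
    intro y z h
    obtain ⟨a, ha, f, hf, e⟩ := Submodule.mem_sup.1
      (h (Submodule.mem_sup_left (Submodule.mem_span_singleton_self y)))
    obtain ⟨r, rfl⟩ := Submodule.mem_span_singleton.1 ha
    exact ⟨r, by rwa [← e, add_sub_cancel_left]⟩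
  exact (chain (R ∙ y ⊔ F) (R ∙ z ⊔ F)).imp (key y z) (key z y)

/-- In a module whose submodules form a chain, a layer of the filtration by path length is spanned
by each of its nonzero homogeneous elements. -/
theorem exists_sub_smul_mem (chain : ∀ S T : Submodule (PathAlgebra K V) M, S ≤ T ∨ T ≤ S)
    {n : ℕ} {j : V} {y z : M} (hy : y ∈ pathFiltration K V M n)
    (hz : z ∈ pathFiltration K V M n) (hz' : z ∉ pathFiltration K V M (n + 1))
    (hj : vertexElt K j • z = z) : ∃ c : K, y - c • z ∈ pathFiltration K V M (n + 1) := by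
  set F := pathFiltration K V M (n + 1) with hF
  have hyj : vertexElt K j • y ∈ pathFiltration K V M n := Submodule.smul_mem _ _ hy
  have idem : ∀ m : M, vertexElt K j • vertexElt K j • m = vertexElt K j • m := by
    intro m; rw [smul_smul, vertexElt_mul_self]
  have h1 : ∃ c : K, vertexElt K j • y - c • z ∈ F := by
    rcases exists_mem_span_singleton_of_chain chain F (vertexElt K j • y) z with ⟨r, hr⟩ | ⟨r, hr⟩
    · obtain ⟨c, hc⟩ := exists_smul_sub_mem hz hj r
      exact ⟨c, by simpa using add_mem hr hc⟩
    · obtain ⟨c, hc⟩ := exists_smul_sub_mem hyj (idem y) r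
      have h : z - c • vertexElt K j • y ∈ F := by simpa using add_mem hr hc
      have hc0 : c ≠ 0 := by
        rintro rfl
        exact hz' (by simpa using h)
      refine ⟨c⁻¹, mem_of_smul_mem_tower hc0 ?_⟩
      rw [smul_sub, smul_smul, mul_inv_cancel₀ hc0, one_smul, ← neg_sub]
      exact neg_mem h
  have h2 : y - vertexElt K j • y ∈ F := by
    set y' := y - vertexElt K j • y
    have hy' : y' ∈ pathFiltration K V M n := sub_mem hy hyj
    have h0 : vertexElt K j • y' = 0 := by rw [smul_sub, idem, sub_self]
    rcases exists_mem_span_singleton_of_chain chain F y' z with ⟨r, hr⟩ | ⟨r, hr⟩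
    · obtain ⟨c, hc⟩ := exists_smul_sub_mem hz hj r
      have h : y' - c • z ∈ F := by simpa using add_mem hr hc
      have h' : c • z ∈ F := by
        have := Submodule.smul_mem F (vertexElt K j) h
        rw [smul_sub, h0, smul_comm, hj, zero_sub] at this
        exact neg_mem_iff.1 this
      simpa using add_mem h h'
    · have h := Submodule.smul_mem F (vertexElt K j) hr
      rw [smul_sub, hj] at h
      exact absurd (by simpa using add_mem h (vertexElt_smul_smul_mem hy' h0 r)) hz'
  obtain ⟨c, hc⟩ := h1
  exact ⟨c, by simpa using add_mem h2 hc⟩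

end PathFiltration

/-! ### Right subpaths -/

section RightSubpaths

variable {V : Type v} [Quiver.{w} V]

theorem IsRightSubpath.length_le {a b c : V} {y : Path a c} {p : Path a b}
    (h : IsRightSubpath y p) : y.length ≤ p.length := by
  obtain ⟨s, rfl⟩ := h
  simp

theorem IsRightSubpath.eq_of_length_eq {a b c d : V} {y : Path a c} {z : Path a d} {p : Path a b}
    (hy : IsRightSubpath y p) (hz : IsRightSubpath z p) (h : y.length = z.length) :
    (⟨c, y⟩ : Σ c, Path a c) = ⟨d, z⟩ := by
  obtain ⟨s, rfl⟩ := hy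
  obtain ⟨t, ht⟩ := hz
  induction s with
  | nil =>
    have ht0 : t.length = 0 := by
      have := congrArg Path.length ht
      simp at this
      omega
    cases t with
    | nil => rw [Path.comp_nil, Path.comp_nil] at ht; rw [ht]
    | cons t a => simp at ht0
  | cons s a ih =>
    cases t with
    | nil =>
      have := congrArg Path.length ht
      simp at this
      omega
    | cons t b =>
      simp only [Path.comp_cons, Path.cons.injEq] at ht
      obtain ⟨rfl, ht, -⟩ := ht
      exact ih t (eq_of_heq ht)

theorem exists_isRightSubpath {a b : V} (p : Path a b) {n : ℕ} (hn : n ≤ p.length) :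
    ∃ (c : V) (y : Path a c), IsRightSubpath y p ∧ y.length = n := by
  induction p with
  | nil => exact ⟨_, Path.nil, ⟨Path.nil, rfl⟩, by simp at hn; simp [hn]⟩
  | cons p α ih =>
    by_cases h : n ≤ p.length
    · obtain ⟨c, y, ⟨s, hs⟩, hy⟩ := ih h
      exact ⟨c, y, ⟨s.cons α, by rw [hs, Path.comp_cons]⟩, hy⟩
    · exact ⟨_, p.cons α, ⟨Path.nil, rfl⟩, by rw [Path.length_cons] at hn ⊢; omega⟩

end RightSubpaths

/-! ### Uniserial modules with a given mast and top element -/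

section Tower

variable {K : Type u} [Field K] {V : Type v} [Fintype V] [Quiver.{w} V]
variable {M : Type x} [AddCommGroup M] [Module (PathAlgebra K V) M]

/-- The submodules of `M` form a chain, and `x` is a homogeneous element of `M` such that `p` is a
longest path with `p x ≠ 0`; all longer paths annihilate `M`. -/
structure IsTower (x : M) {a b : V} (p : Path a b) : Prop where
  chain : ∀ S T : Submodule (PathAlgebra K V) M, S ≤ T ∨ T ≤ S
  idem : vertexElt K a • x = x
  ne_zero : pathElt K p • x ≠ 0
  kill : ∀ r ∈ pathSpan K V (p.length + 1), ∀ m : M, r • m = 0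

namespace IsTower

variable {x : M} {a b : V} {p : Path a b}

theorem pathFiltration_eq_bot (h : IsTower (K := K) x p) {n : ℕ} (hn : p.length + 1 ≤ n) :
    pathFiltration K V M n = ⊥ :=
  _root_.pathFiltration_eq_bot fun r hr => h.kill r (pathSpan_anti hn hr)

theorem smul_eq_zero (h : IsTower (K := K) x p) {i j : ℕ} (hij : p.length + 1 ≤ i + j)
    {r : PathAlgebra K V} (hr : r ∈ pathSpan K V i) {m : M} (hm : m ∈ pathFiltration K V M j) :
    r • m = 0 := by
  have := smul_mem_pathFiltration_add hr hm
  rwa [h.pathFiltration_eq_bot hij, Submodule.mem_bot] at this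

theorem pathElt_smul_mem {c : V} (y : Path a c) (x : M) :
    pathElt K y • x ∈ pathFiltration K V M y.length :=
  smul_mem_pathFiltration (pathElt_mem_pathSpan K y le_rfl) x

theorem pathElt_smul_notMem (h : IsTower (K := K) x p) {c : V} {y : Path a c}
    (hy : IsRightSubpath y p) : pathElt K y • x ∉ pathFiltration K V M (y.length + 1) := by
  obtain ⟨s, rfl⟩ := hy
  intro hm
  refine h.ne_zero ?_
  rw [pathElt_comp, mul_smul]
  exact h.smul_eq_zero (by rw [Path.length_comp]; omega) (pathElt_mem_pathSpan K s le_rfl) hm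

variable [Module K M] [IsScalarTower K (PathAlgebra K V) M]

theorem exists_sub_smul_pathElt_mem (h : IsTower (K := K) x p) {c : V} {y : Path a c}
    (hy : IsRightSubpath y p) {m : M} (hm : m ∈ pathFiltration K V M y.length) :
    ∃ k : K, m - k • pathElt K y • x ∈ pathFiltration K V M (y.length + 1) :=
  exists_sub_smul_mem h.chain (j := c) hm (pathElt_smul_mem y x) (h.pathElt_smul_notMem hy)
    (by rw [smul_smul, vertexElt_mul_pathElt])

/-- A homogeneous element at the start of `p` is a multiple of the top element up to a deep layer,
if the start of `p` is not passed again too early. -/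
theorem exists_sub_smul_mem_of_no_return (h : IsTower (K := K) x p) {x' : M}
    (hx' : vertexElt K a • x' = x') {n : ℕ} (hn : n ≤ p.length)
    (no : ∀ y : Path a a, IsRightSubpath y p → 1 ≤ y.length → n < y.length) :
    ∃ k : K, x' - k • x ∈ pathFiltration K V M (n + 1) := by
  induction n with
  | zero =>
    obtain ⟨k, hk⟩ := h.exists_sub_smul_pathElt_mem (y := Path.nil) ⟨p, by simp⟩
      (mem_pathFiltration_zero x')
    rw [pathElt_nil, h.idem] at hk
    exact ⟨k, hk⟩
  | succ n ih =>
    obtain ⟨k, hk⟩ := ih (by omega) fun y hy hy' => (Nat.lt_succ_self n).trans (no y hy hy')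
    refine ⟨k, ?_⟩
    obtain ⟨c, y, hy, hyn⟩ := exists_isRightSubpath p hn
    obtain ⟨l, hl⟩ := h.exists_sub_smul_pathElt_mem hy (hyn ▸ hk)
    have hca : a ≠ c := by
      rintro rfl
      have := no y hy (by omega)
      omega
    have := Submodule.smul_mem _ (vertexElt K a) hl
    rwa [smul_sub, smul_sub, hx', smul_comm, h.idem, smul_comm _ l, ← vertexElt_mul_pathElt K y,
      mul_smul, smul_smul, vertexElt_mul_of_ne K hca, zero_smul, smul_zero, sub_zero, hyn] at this

end IsTower

/-- The span of the elements `y x`, where `y` runs through the proper right subpaths of `p` of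
length at least `n`. -/
def subpathSpan (K : Type u) [Field K] {V : Type v} [Fintype V] [Quiver.{w} V] {M : Type x}
    [AddCommGroup M] [Module (PathAlgebra K V) M] [Module K M]
    (x : M) {a b : V} (p : Path a b) (n : ℕ) : Submodule K M :=
  Submodule.span K {m | ∃ (c : V) (y : Path a c), IsRightSubpath y p ∧ n ≤ y.length ∧
    y.length < p.length ∧ pathElt K y • x = m}

variable [Module K M] {x : M} {a b : V} {p : Path a b}

theorem subpathSpan_eq_bot {n : ℕ} (hn : p.length ≤ n) : subpathSpan K x p n = ⊥ := by
  refine Submodule.span_eq_bot.2 ?_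
  rintro _ ⟨c, y, -, h1, h2, -⟩
  omega

theorem exists_mem_subpathSpan_succ {n : ℕ} {c : V} {y : Path a c} (hy : IsRightSubpath y p)
    (hn : y.length = n) {m : M} (hm : m ∈ subpathSpan K x p n) :
    ∃ k : K, m - k • pathElt K y • x ∈ subpathSpan K x p (n + 1) := by
  refine Submodule.span_induction (p := fun m _ => ∃ k : K, m - k • pathElt K y • x ∈
    subpathSpan K x p (n + 1)) ?_ ⟨0, by simp⟩ ?_ ?_ hm
  · rintro _ ⟨d, z, hz, hnz, hzp, rfl⟩
    rcases hnz.eq_or_lt with h | h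
    · cases hy.eq_of_length_eq hz (hn.trans h)
      exact ⟨1, by simp⟩
    · refine ⟨0, ?_⟩
      rw [zero_smul, sub_zero]
      exact Submodule.subset_span ⟨d, z, hz, h, hzp, rfl⟩
  · rintro m m' _ _ ⟨k, hk⟩ ⟨k', hk'⟩
    exact ⟨k + k', by rw [add_smul, add_sub_add_comm]; exact add_mem hk hk'⟩
  · rintro c m _ ⟨k, hk⟩
    exact ⟨c * k, by rw [mul_smul, ← smul_sub]; exact Submodule.smul_mem _ _ hk⟩

variable [IsScalarTower K (PathAlgebra K V) M]

theorem subpathSpan_le (n : ℕ) {m : M} (hm : m ∈ subpathSpan K x p n) :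
    m ∈ pathFiltration K V M n := by
  refine Submodule.span_induction (p := fun m _ => m ∈ pathFiltration K V M n) ?_ (zero_mem _)
    (fun _ _ _ _ => add_mem) (fun k _ _ => Submodule.smul_of_tower_mem _ k) hm
  rintro _ ⟨c, y, -, hy, -, rfl⟩
  exact pathFiltration_anti hy (IsTower.pathElt_smul_mem y x)

theorem IsTower.notMem_subpathSpan (h : IsTower (K := K) x p) (n : ℕ) :
    pathElt K p • x ∉ subpathSpan K x p n := by
  intro hm
  obtain ⟨k, hk⟩ : ∃ k, p.length ≤ n + k := ⟨p.length, by omega⟩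
  induction k generalizing n with
  | zero =>
    rw [subpathSpan_eq_bot (by omega)] at hm
    exact h.ne_zero hm
  | succ k ih =>
    by_cases hn : p.length ≤ n
    · rw [subpathSpan_eq_bot hn] at hm
      exact h.ne_zero hm
    · obtain ⟨c, y, hy, hyn⟩ := exists_isRightSubpath p (n := n) (by omega)
      obtain ⟨l, hl⟩ := exists_mem_subpathSpan_succ hy hyn hm
      have hpx : pathElt K p • x ∈ pathFiltration K V M (n + 1) :=
        pathFiltration_anti (by omega) (pathElt_smul_mem p x)
      have hl0 : l = 0 := by
        by_contra hl0
        have h1 := sub_mem hpx (subpathSpan_le (n + 1) hl)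
        rw [sub_sub_cancel] at h1
        exact h.pathElt_smul_notMem hy (by rw [hyn]; exact mem_of_smul_mem_tower hl0 h1)
      rw [hl0, zero_smul, sub_zero] at hl
      exact ih (n + 1) hl (by omega)

/-- If the start of `p` is not passed again early enough, then the coefficient of `p x` in the
expansion of `α u x` is independent of the top element `x`. -/
theorem IsTower.coeff_unique (h : IsTower (K := K) x p) {x' : M}
    (hx' : vertexElt K a • x' = x') (hpx' : pathElt K p • x' ≠ 0) {c d : V} (u : Path a c)
    (α : c ⟶ d) (hu : u.length < p.length) {k k' : K}
    (hk : pathElt K (u.cons α) • x - k • pathElt K p • x ∈ subpathSpan K x p (u.length + 1))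
    (hk' : pathElt K (u.cons α) • x' - k' • pathElt K p • x' ∈
      subpathSpan K x' p (u.length + 1))
    (no : ∀ y : Path a a, IsRightSubpath y p → 1 ≤ y.length →
      p.length - u.length - 1 < y.length) : k = k' := by
  obtain ⟨t, ht⟩ := h.exists_sub_smul_mem_of_no_return hx' (n := p.length - u.length - 1)
    (by omega) no
  have deep : ∀ r ∈ pathSpan K V (u.length + 1), r • x' = t • r • x := by
    intro r hr
    have := h.smul_eq_zero (by omega) hr ht
    rwa [smul_sub, sub_eq_zero, smul_comm] at this
  have hp : pathElt K p • x' = t • pathElt K p • x :=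
    deep _ (pathElt_mem_pathSpan K p (by omega))
  have ht0 : t ≠ 0 := by
    rintro rfl
    rw [zero_smul] at hp
    exact hpx' hp
  have hle : subpathSpan K x' p (u.length + 1) ≤ subpathSpan K x p (u.length + 1) := by
    refine Submodule.span_le.2 ?_
    rintro _ ⟨e, y, hy, h1, h2, rfl⟩
    rw [deep _ (pathElt_mem_pathSpan K y h1)]
    exact Submodule.smul_mem _ t (Submodule.subset_span ⟨e, y, hy, h1, h2, rfl⟩)
  have h' := hle hk'
  rw [deep _ (pathElt_mem_pathSpan K (u.cons α) le_rfl), hp] at h'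
  have h'' := sub_mem h' (Submodule.smul_mem _ t hk)
  have e : t • pathElt K (u.cons α) • x - k' • t • pathElt K p • x -
      t • (pathElt K (u.cons α) • x - k • pathElt K p • x) =
      (t * (k - k')) • pathElt K p • x := by
    generalize pathElt K (u.cons α) • x = m
    generalize pathElt K p • x = n
    module
  rw [e] at h''
  by_contra hne
  have := Submodule.smul_mem _ (t * (k - k'))⁻¹ h''
  rw [smul_smul, inv_mul_cancel₀ (mul_ne_zero ht0 (sub_ne_zero.2 hne)), one_smul] at this
  exact h.notMem_subpathSpan _ this

end Tower

section TowerModules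

variable {K : Type u} [Field K] {V : Type v} [Fintype V] [Quiver.{w} V]

/-- A uniserial module over `KΓ/I` with mast `p`, together with a top element, regarded as a module
over `KΓ`. -/
structure TowerModule (I : Ideal (PathAlgebra K V)) {a b : V} (p : Path a b) where
  carrier : Type max u v w
  [addCommGroup : AddCommGroup carrier]
  [module : Module (PathAlgebra K V) carrier]
  [scalars : Module K carrier]
  [isScalarTower : IsScalarTower K (PathAlgebra K V) carrier]
  torsion : ∀ r ∈ I, ∀ m : carrier, r • m = 0
  top : carrier
  isTower : IsTower (K := K) top p

attribute [instance] TowerModule.addCommGroup TowerModule.module TowerModule.scalars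
  TowerModule.isScalarTower

/-! ### Uniserial modules as towers -/

section OfMast

theorem pathSpan_le_of_forall_mem {I : Ideal (PathAlgebra K V)} {n : ℕ}
    (h : ∀ (i j : V) (p : Path i j), n ≤ p.length → pathElt K p ∈ I) :
    pathSpan K V n ≤ I.restrictScalars K := by
  refine Submodule.span_le.2 ?_
  rintro _ ⟨i, j, p, hp, rfl⟩
  exact h i j p hp

variable {I : Ideal (PathAlgebra K V)} [I.IsTwoSided]

theorem mk_mem_jacobson (hI : IsAdmissible I) {r : PathAlgebra K V} (hr : r ∈ pathSpan K V 1) :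
    Ideal.Quotient.mk I r ∈ Ring.jacobson (PathAlgebra K V ⧸ I) := by
  rw [← Ideal.jacobson_bot, Ideal.mem_jacobson_iff]
  intro y
  obtain ⟨y, rfl⟩ := Ideal.Quotient.mk_surjective y
  obtain ⟨n, hn⟩ := hI.2
  have hn' := pathSpan_le_of_forall_mem hn
  have hyr : y * r ∈ pathSpan K V 1 :=
    pathSpan_anti (by omega) (mul_mem_pathSpan (mem_pathSpan_zero y) hr)
  have hpow : ∀ m : ℕ, (y * r) ^ m ∈ pathSpan K V m := by
    intro m
    induction m with
    | zero => exact mem_pathSpan_zero _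
    | succ m ih => rw [pow_succ]; exact mul_mem_pathSpan ih hyr
  have hnil : IsNilpotent (Ideal.Quotient.mk I (y * r)) :=
    ⟨n, by rw [← map_pow]; exact Ideal.Quotient.eq_zero_iff_mem.2 (hn' (hpow n))⟩
  obtain ⟨t, ht⟩ := hnil.isUnit_one_add
  refine ⟨(t⁻¹ : (PathAlgebra K V ⧸ I)ˣ), ?_⟩
  have : ((t⁻¹ : (PathAlgebra K V ⧸ I)ˣ) : PathAlgebra K V ⧸ I) *
      (1 + Ideal.Quotient.mk I (y * r)) = 1 := by rw [← ht, Units.inv_mul]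
  rw [mul_add, mul_one, map_mul, ← mul_assoc] at this
  rw [Ideal.mem_bot, sub_eq_zero, ← this, add_comm]

variable (I) in
/-- The `KΓ`-module structure on a `KΓ/I`-module. -/
@[reducible] def pathModule (U : Type x) [AddCommGroup U] [Module (PathAlgebra K V ⧸ I) U] :
    Module (PathAlgebra K V) U :=
  Module.compHom U (Ideal.Quotient.mk I)

variable (I) in
/-- The `K`-module structure on a `KΓ/I`-module. -/
@[reducible] def scalarModule (U : Type x) [AddCommGroup U] [Module (PathAlgebra K V ⧸ I) U] :
    Module K U :=
  Module.compHom U ((Ideal.Quotient.mk I).comp (algebraMap K (PathAlgebra K V)))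

variable {U : Type x} [AddCommGroup U] [Module (PathAlgebra K V ⧸ I) U]

theorem scalarModule_isScalarTower :
    letI := pathModule I U
    letI := scalarModule I U
    IsScalarTower K (PathAlgebra K V) U := by
  let := pathModule I U
  let := scalarModule I U
  refine ⟨fun k r m => ?_⟩
  change Ideal.Quotient.mk I (k • r) • m =
    Ideal.Quotient.mk I (algebraMap K (PathAlgebra K V) k) • Ideal.Quotient.mk I r • m
  rw [smul_smul, ← map_mul, Algebra.smul_def]

variable (I) in
/-- A `KΓ`-submodule of a `KΓ/I`-module, as a `KΓ/I`-submodule. -/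
def quotientSubmodule (S : letI := pathModule I U; Submodule (PathAlgebra K V) U) :
    Submodule (PathAlgebra K V ⧸ I) U :=
  letI := pathModule I U
  { carrier := S
    add_mem' := fun h h' => S.add_mem h h'
    zero_mem' := S.zero_mem
    smul_mem' := fun c m h => by
      obtain ⟨r, rfl⟩ := Ideal.Quotient.mk_surjective c
      exact S.smul_mem r h }

theorem chain_of_isUniserial (hU : IsUniserial (PathAlgebra K V ⧸ I) U) :
    letI := pathModule I U
    ∀ S T : Submodule (PathAlgebra K V) U, S ≤ T ∨ T ≤ S := by
  let := pathModule I U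
  intro S T
  exact hU.chain (quotientSubmodule I S) (quotientSubmodule I T)

theorem pathFiltration_eq_bot_of_length_le (hI : IsAdmissible I) {n : ℕ}
    (hlen : Module.length (PathAlgebra K V ⧸ I) U ≤ n) :
    letI := pathModule I U
    pathFiltration K V U n = ⊥ := by
  let := pathModule I U
  let := scalarModule I U
  have : IsScalarTower K (PathAlgebra K V) U := scalarModule_isScalarTower
  by_contra hne
  obtain ⟨N, hN⟩ := hI.2
  have hbot : pathFiltration K V U N = ⊥ := by
    refine pathFiltration_eq_bot fun r hr m => ?_
    have hr' := pathSpan_le_of_forall_mem hN hr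
    change Ideal.Quotient.mk I r • m = 0
    rw [Ideal.Quotient.eq_zero_iff_mem.2 hr', zero_smul]
  have strict : ∀ i ≤ n, pathFiltration K V U (i + 1) < pathFiltration K V U i := by
    intro i hi
    refine lt_of_le_not_ge (pathFiltration_anti (Nat.le_succ i)) fun h => hne ?_
    refine eq_bot_iff.2
      ((pathFiltration_anti hi).trans ((pathFiltration_le_of_stable h N).trans ?_))
    rw [← hbot]
    exact pathFiltration_anti (by omega)
  let s : LTSeries (Submodule (PathAlgebra K V ⧸ I) U) :=
    LTSeries.mk (n + 1) (fun i => quotientSubmodule I (pathFiltration K V U (n + 1 - i))) (by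
      refine Fin.strictMono_iff_lt_succ.2 fun i => ?_
      have hi := i.2
      have := strict (n - i) (by omega)
      have e : n + 1 - (i : ℕ) = n - i + 1 := by omega
      simp only [Fin.val_castSucc, Fin.val_succ, e, Nat.add_sub_add_right]
      exact this)
  have h1 := Order.LTSeries.length_le_krullDim s
  rw [← Module.coe_length] at h1
  have h2 : ((n + 1 : ℕ) : ℕ∞) ≤ Module.length (PathAlgebra K V ⧸ I) U := by exact_mod_cast h1
  have h3 := h2.trans hlen
  norm_cast at h3
  omega

theorem isTower_of_isMastOf (hI : IsAdmissible I) {a b : V} {p : Path a b}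
    (hU : IsMastOf I U p) {x : U} (hx : IsTopElement I x) :
    letI := pathModule I U
    IsTower (K := K) x p := by
  let := pathModule I U
  let := scalarModule I U
  have : IsScalarTower K (PathAlgebra K V) U := scalarModule_isScalarTower
  obtain ⟨huni, hlen, m, hm⟩ := hU
  obtain ⟨hxJ, e, he⟩ := hx
  change pathElt K p • m ≠ 0 at hm
  change vertexElt K e • x = x at he
  have chain := chain_of_isUniserial huni
  have hbot := pathFiltration_eq_bot_of_length_le (n := p.length + 1) hI (by rw [hlen]; norm_cast)
  have kill : ∀ r ∈ pathSpan K V (p.length + 1), ∀ m : U, r • m = 0 := by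
    intro r hr m
    have := smul_mem_pathFiltration hr m
    rwa [hbot, Submodule.mem_bot] at this
  have hx1 : x ∉ pathFiltration K V U 1 := by
    intro h
    refine hxJ (Submodule.span_induction (p := fun m _ => m ∈
      Ring.jacobson (PathAlgebra K V ⧸ I) • (⊤ : Submodule (PathAlgebra K V ⧸ I) U))
      ?_ (zero_mem _) (fun _ _ _ _ => add_mem) ?_ h)
    · rintro _ ⟨r, hr, m', rfl⟩
      exact Submodule.smul_mem_smul (mk_mem_jacobson hI hr) (Submodule.mem_top (x := m'))
    · intro r m' _ h
      exact Submodule.smul_mem _ (Ideal.Quotient.mk I r) h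
  obtain ⟨c, hc⟩ := exists_sub_smul_mem chain (mem_pathFiltration_zero m)
    (mem_pathFiltration_zero x) hx1 he
  have hp : pathElt K p • m = c • pathElt K p • x := by
    have := smul_mem_pathFiltration_add (pathElt_mem_pathSpan K p le_rfl) hc
    rwa [zero_add, hbot, Submodule.mem_bot, smul_sub, sub_eq_zero, smul_comm] at this
  have hpx : pathElt K p • x ≠ 0 := by
    intro h0
    rw [h0, smul_zero] at hp
    exact hm hp
  have hea : a = e := by
    by_contra h
    refine hpx ?_
    rw [← he, ← pathElt_mul_vertexElt K p, mul_smul, smul_smul (vertexElt K a),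
      vertexElt_mul_of_ne K h, zero_smul, smul_zero]
  subst hea
  exact ⟨chain, he, hpx, kill⟩

/-- The tower given by a uniserial module with mast `p` and a top element. -/
def TowerModule.ofMast (hI : IsAdmissible I) {U : Type max u v w} [AddCommGroup U]
    [Module (PathAlgebra K V ⧸ I) U] {a b : V} {p : Path a b}
    (hU : IsMastOf I U p) {x : U} (hx : IsTopElement I x) : TowerModule I p :=
  letI := pathModule I U
  letI := scalarModule I U
  haveI : IsScalarTower K (PathAlgebra K V) U := scalarModule_isScalarTower
  { carrier := U
    torsion := fun r hr m => by
      change Ideal.Quotient.mk I r • m = 0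
      rw [Ideal.Quotient.eq_zero_iff_mem.2 hr, zero_smul]
    top := x
    isTower := isTower_of_isMastOf hI hU hx }

end OfMast

end TowerModules

/-- A subquotient of a module over an algebra, presented by a surjection from a submodule. -/
theorem exists_subquotient {K R : Type*} [CommRing K] [Ring R] [Algebra K R] {M : Type x}
    [AddCommGroup M] [Module R M] [Module K M] [IsScalarTower K R M] (S F : Submodule R M) :
    ∃ (N : Type x) (_ : AddCommGroup N) (_ : Module R N) (_ : Module K N)
      (_ : IsScalarTower K R N) (π : S →ₗ[R] N), Function.Surjective π ∧
        ∀ m : S, π m = 0 ↔ (m : M) ∈ F :=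
  ⟨S ⧸ F.submoduleOf S, inferInstance, inferInstance, inferInstance, inferInstance,
    (F.submoduleOf S).mkQ, Submodule.mkQ_surjective _, fun m => by
      rw [Submodule.mkQ_apply, Submodule.Quotient.mk_eq_zero]; rfl⟩

/-- The pullback of a module along an endomorphism of an algebra. -/
theorem exists_pullback {K R : Type*} [CommRing K] [Ring R] [Algebra K R] (σ : R →ₐ[K] R)
    (M : Type x) [AddCommGroup M] [Module R M] [Module K M] [IsScalarTower K R M] :
    ∃ (N : Type x) (_ : AddCommGroup N) (_ : Module R N) (_ : Module K N)
      (_ : IsScalarTower K R N) (f : M ≃ₗ[K] N), ∀ (r : R) (m : M), r • f m = f (σ r • m) := by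
  refine ⟨M, inferInstance, Module.compHom M σ.toRingHom, inferInstance, ?_,
    LinearEquiv.refl K M, fun _ _ => rfl⟩
  refine @IsScalarTower.mk K R M _ (_) _ fun k r m => ?_
  change σ (k • r) • m = k • σ r • m
  rw [map_smul, smul_assoc]

section TowerOperations

variable {K : Type u} [Field K] {V : Type v} [Fintype V] [Quiver.{w} V]
variable {I : Ideal (PathAlgebra K V)}

/-! ### Subquotients of towers -/

/-- A segment `q` of a mast is again a mast, namely of a subquotient. -/
theorem TowerModule.exists_segment {a b c d : V} {p : Path a b} {r : Path a c} {q : Path c d}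
    {s : Path d b} (T : TowerModule I p) (hp : p = r.comp (q.comp s)) :
    ∃ T' : TowerModule I q, ∀ z : PathAlgebra K V,
      z • pathElt K r • T.top ∈ pathFiltration K V T.carrier (r.length + q.length + 1) →
        z • T'.top = 0 := by
  subst hp
  set y := pathElt K r • T.top with hy
  set S : Submodule (PathAlgebra K V) T.carrier := (PathAlgebra K V) ∙ y with hS
  set F := pathFiltration K V T.carrier (r.length + q.length + 1) with hF
  have hyS : y ∈ S := Submodule.mem_span_singleton_self y
  have hyr : y ∈ pathFiltration K V T.carrier r.length := IsTower.pathElt_smul_mem r T.top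
  have hSr : S ≤ pathFiltration K V T.carrier r.length := by
    rw [hS, Submodule.span_singleton_le_iff_mem]
    exact hyr
  obtain ⟨N, _, _, _, _, π, hπ, hker⟩ := exists_subquotient (K := K) S F
  have hsmul : ∀ (z : PathAlgebra K V) (m : S), z • π m = π (z • m) :=
    fun z m => (π.map_smul z m).symm
  refine ⟨{ carrier := N
            torsion := ?_
            top := π ⟨y, hyS⟩
            isTower := ⟨?_, ?_, ?_, ?_⟩ }, fun z hz => ?_⟩
  · intro t ht m
    obtain ⟨m, rfl⟩ := hπ m
    rw [hsmul, hker]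
    change t • (m : T.carrier) ∈ F
    rw [T.torsion t ht]
    exact zero_mem _
  · intro A B
    have key : ∀ A B : Submodule (PathAlgebra K V) N,
        (A.comap π).map S.subtype ≤ (B.comap π).map S.subtype → A ≤ B := by
      intro A B h m hm
      obtain ⟨m, rfl⟩ := hπ m
      obtain ⟨m', hm', e⟩ := h ⟨m, hm, rfl⟩
      cases Subtype.ext e
      exact hm'
    exact (T.isTower.chain _ _).imp (key A B) (key B A)
  · rw [hsmul]
    congr 1
    refine Subtype.ext ?_
    change vertexElt K c • pathElt K r • T.top = pathElt K r • T.top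
    rw [smul_smul, vertexElt_mul_pathElt]
  · intro h
    rw [hsmul, hker] at h
    have h' : pathElt K q • pathElt K r • T.top ∈ F := h
    refine T.isTower.ne_zero ?_
    rw [pathElt_comp, pathElt_comp, mul_smul, mul_smul]
    exact T.isTower.smul_eq_zero (by simp only [Path.length_comp]; omega)
      (pathElt_mem_pathSpan K s le_rfl) h'
  · intro t ht m
    obtain ⟨m, rfl⟩ := hπ m
    rw [hsmul, hker]
    exact pathFiltration_anti (by omega) (smul_mem_pathFiltration_add ht (hSr m.2))
  · change z • π ⟨y, hyS⟩ = 0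
    rw [hsmul, hker]
    exact hz

/-! ### Shearing a tower -/

/-- The tower with the module structure pulled back along the shear `α ↦ α + k q`. -/
theorem TowerModule.exists_shear (hI : IsAdmissible I) {c d : V} {q : Path c d}
    (T : TowerModule I q) (hq : 1 ≤ q.length) (α : c ⟶ d)
    (hα : ¬ IsRightSubpath ((Path.nil : Path c c).cons α) q) (k : K) :
    ∃ (T' : TowerModule I q) (f : T.carrier →ₗ[K] T'.carrier), T'.top = f T.top ∧
      (∀ (e : V) (y : Path c e), IsRightSubpath y q → ∀ m, pathElt K y • f m =
        f (pathElt K y • m)) ∧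
      ∀ m, arrowElt K α • f m = f (arrowElt K α • m + k • pathElt K q • m) := by
  have fix : ∀ r ∈ pathSpan K V 2, ∀ m : T.carrier, shear α q k r • m = r • m := by
    intro r hr m
    have := T.isTower.kill _ (pathSpan_anti (by omega) (shear_sub_mem α q k hq hr)) m
    rwa [sub_smul, sub_eq_zero] at this
  have sub : ∀ (e : V) (y : Path c e), IsRightSubpath y q → ∀ m : T.carrier,
      shear α q k (pathElt K y) • m = pathElt K y • m := by
    intro e y hy m
    by_cases h2 : 2 ≤ y.length
    · exact fix _ (pathElt_mem_pathSpan K y h2) m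
    · cases y with
      | nil => rw [pathElt_nil, shear_vertexElt]
      | cons y β =>
        cases y with
        | nil =>
          rw [pathElt_single, shear_arrowElt_of_ne]
          intro h
          cases h
          exact hα hy
        | cons y γ => simp at h2
  have arrow : ∀ m : T.carrier, shear α q k (arrowElt K α) • m =
      arrowElt K α • m + k • pathElt K q • m := by
    intro m
    rw [shear_arrowElt_self, add_smul, smul_assoc]
  obtain ⟨N, _, _, _, _, f, hf⟩ := exists_pullback (shear α q k) T.carrier
  have stable : ∀ (S : Submodule (PathAlgebra K V) N) (r : PathAlgebra K V) (m : T.carrier),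
      f m ∈ S → f (r • m) ∈ S := by
    intro S r m hm
    have base : ∀ (r : PathAlgebra K V) (m : T.carrier), f m ∈ S → f (shear α q k r • m) ∈ S := by
      intro r m hm
      rw [← hf]
      exact S.smul_mem r hm
    refine path_induction (P := fun r => f (r • m) ∈ S) ?_ ?_ ?_ ?_ r
    · intro i j p
      induction p with
      | nil =>
        have := base (vertexElt K i) m hm
        rwa [shear_vertexElt] at this
      | @cons j e p β ih =>
        rw [pathElt_cons, mul_smul]
        have h := base (arrowElt K β) _ ih
        by_cases hβ : (⟨j, e, β⟩ : Σ i j : V, (i ⟶ j)) = ⟨c, d, α⟩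
        · cases hβ
          rw [arrow] at h
          have h' := Submodule.smul_of_tower_mem S k (base (pathElt K q) _ ih)
          rw [sub d q ⟨Path.nil, rfl⟩, ← f.map_smul] at h'
          have h'' := sub_mem h h'
          rwa [← map_sub, add_sub_cancel_right] at h''
        · rwa [shear_arrowElt_of_ne α q k β hβ] at h
    · rw [zero_smul, map_zero]; exact zero_mem _
    · intro r s hr hs
      rw [add_smul, map_add]; exact add_mem hr hs
    · intro l r hr
      rw [smul_assoc, f.map_smul]; exact Submodule.smul_of_tower_mem _ l hr
  let pull : Submodule (PathAlgebra K V) N → Submodule (PathAlgebra K V) T.carrier := fun S =>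
    { carrier := {m | f m ∈ S}
      add_mem' := fun {m m'} h h' => by
        change f (m + m') ∈ S
        rw [map_add]
        exact S.add_mem h h'
      zero_mem' := by
        change f 0 ∈ S
        rw [map_zero]
        exact S.zero_mem
      smul_mem' := fun r m hm => stable S r m hm }
  have pull_le : ∀ A B, pull A ≤ pull B → A ≤ B := by
    intro A B h m hm
    obtain ⟨m, rfl⟩ := f.surjective m
    exact h hm
  refine ⟨{ carrier := N
            torsion := ?_
            top := f T.top
            isTower := ⟨?_, ?_, ?_, ?_⟩ }, f.toLinearMap, rfl, ?_, ?_⟩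
  · intro r hr m
    obtain ⟨m, rfl⟩ := f.surjective m
    rw [hf, fix r (hI.1 r hr) m, T.torsion r hr, map_zero]
  · intro A B
    exact (T.isTower.chain (pull A) (pull B)).imp (pull_le A B) (pull_le B A)
  · rw [hf, shear_vertexElt, T.isTower.idem]
  · rw [hf, sub d q ⟨Path.nil, rfl⟩]
    exact fun h => T.isTower.ne_zero (f.injective (h.trans (map_zero f).symm))
  · intro r hr m
    obtain ⟨m, rfl⟩ := f.surjective m
    rw [hf, fix r (pathSpan_anti (by omega) hr), T.isTower.kill r hr, map_zero]
  · intro e y hy m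
    exact (hf _ _).trans (congrArg f (sub e y hy m))
  · intro m
    exact (hf _ _).trans (congrArg f (arrow m))

/-! ### Infinite families of towers -/

theorem TowerModule.exists_smul_top {a b : V} {p : Path a b} (T : TowerModule I p)
    (m : T.carrier) : ∃ r : PathAlgebra K V, r • T.top = m := by
  suffices h : ∀ n, ∀ m : T.carrier, ∃ r : PathAlgebra K V,
      m - r • T.top ∈ pathFiltration K V T.carrier n by
    obtain ⟨r, hr⟩ := h (p.length + 1) m
    rw [T.isTower.pathFiltration_eq_bot le_rfl, Submodule.mem_bot, sub_eq_zero] at hr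
    exact ⟨r, hr.symm⟩
  intro n
  induction n with
  | zero => exact fun m => ⟨0, mem_pathFiltration_zero _⟩
  | succ n ih =>
    intro m
    obtain ⟨r, hr⟩ := ih m
    by_cases hn : n ≤ p.length
    · obtain ⟨c, y, hy, rfl⟩ := exists_isRightSubpath p hn
      obtain ⟨k, hk⟩ := T.isTower.exists_sub_smul_pathElt_mem hy hr
      refine ⟨r + k • pathElt K y, ?_⟩
      rwa [add_smul, smul_assoc, ← sub_sub]
    · rw [T.isTower.pathFiltration_eq_bot (by omega), Submodule.mem_bot] at hr
      exact ⟨r, by rw [hr]; exact zero_mem _⟩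

theorem exists_linearEquiv_of_infinite [I.IsTwoSided] (hfin : FiniteUniserialType I)
    {ι : Type*} [Infinite ι] {a b : V} {p : Path a b} (T : ι → TowerModule I p) :
    ∃ i j : ι, i ≠ j ∧ Nonempty ((T i).carrier ≃ₗ[PathAlgebra K V] (T j).carrier) := by
  obtain ⟨n, M, hM⟩ := hfin
  have tors : ∀ i, Module.IsTorsionBySet (PathAlgebra K V) (T i).carrier I :=
    fun i m r => (T i).torsion r.1 r.2 m
  let inst : ∀ i, Module (PathAlgebra K V ⧸ I) (T i).carrier := fun i => (tors i).module
  have mk_smul : ∀ i (r : PathAlgebra K V) (m : (T i).carrier),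
      Ideal.Quotient.mk I r • m = r • m := fun i r m => rfl
  have huni : ∀ i, IsUniserial (PathAlgebra K V ⧸ I) (T i).carrier := by
    intro i
    refine ⟨?_, ?_, ?_⟩
    · refine Module.Finite.of_surjective
        (LinearMap.toSpanSingleton (PathAlgebra K V ⧸ I) (T i).carrier (T i).top) fun m => ?_
      obtain ⟨r, rfl⟩ := (T i).exists_smul_top m
      exact ⟨Ideal.Quotient.mk I r, rfl⟩
    · exact ⟨⟨_, _, (T i).isTower.ne_zero⟩⟩
    · intro A B
      let A' : Submodule (PathAlgebra K V) (T i).carrier :=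
        { carrier := A, add_mem' := A.add_mem, zero_mem' := A.zero_mem,
          smul_mem' := fun r m hm => A.smul_mem (Ideal.Quotient.mk I r) hm }
      let B' : Submodule (PathAlgebra K V) (T i).carrier :=
        { carrier := B, add_mem' := B.add_mem, zero_mem' := B.zero_mem,
          smul_mem' := fun r m hm => B.smul_mem (Ideal.Quotient.mk I r) hm }
      exact (T i).isTower.chain A' B'
  choose f hf using fun i => hM (T i).carrier (huni i)
  obtain ⟨i, j, hij, he⟩ := Finite.exists_ne_map_eq_of_infinite f
  refine ⟨i, j, hij, ?_⟩
  obtain ⟨φ⟩ := hf i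
  obtain ⟨ψ⟩ := hf j
  rw [← he] at ψ
  let χ := φ.trans ψ.symm
  exact ⟨{ χ.toAddEquiv with map_smul' := fun r m => χ.map_smul (Ideal.Quotient.mk I r) m }⟩

theorem map_subpathSpan {M N : Type x} [AddCommGroup M] [Module (PathAlgebra K V) M] [Module K M]
    [AddCommGroup N] [Module (PathAlgebra K V) N] [Module K N] (f : M →ₗ[K] N)
    {a b : V} {p : Path a b} {x : M} {n : ℕ}
    (hf : ∀ (c : V) (y : Path a c), IsRightSubpath y p →
      pathElt K y • f x = f (pathElt K y • x)) {m : M} (hm : m ∈ subpathSpan K x p n) :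
    f m ∈ subpathSpan K (f x) p n := by
  refine (Submodule.span_le.2 ?_ : subpathSpan K x p n ≤ (subpathSpan K (f x) p n).comap f) hm
  rintro _ ⟨c, y, hy, h1, h2, rfl⟩
  exact Submodule.subset_span ⟨c, y, hy, h1, h2, hf c y hy⟩

/-- If the coefficient of `p x` in the expansion of `α u x` takes infinitely many values, then the
path `p` returns early to its starting vertex. -/
theorem exists_return_of_infinite [I.IsTwoSided] (hfin : FiniteUniserialType I) {a b c d : V}
    {p : Path a b} (u : Path a c) (α : c ⟶ d) (hu : u.length < p.length) {S : Set K}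
    (hS : S.Infinite) (h : ∀ k ∈ S, ∃ T : TowerModule I p,
      pathElt K (u.cons α) • T.top - k • pathElt K p • T.top ∈
        subpathSpan K T.top p (u.length + 1)) :
    ∃ y : Path a a, IsRightSubpath y p ∧ 1 ≤ y.length ∧ y.length ≤ p.length - u.length - 1 := by
  by_contra! no
  choose T hT using fun k : S => h k k.2
  have : Infinite S := hS.to_subtype
  obtain ⟨i, j, hij, ⟨φ⟩⟩ := exists_linearEquiv_of_infinite hfin T
  let f : (T i).carrier →ₗ[K] (T j).carrier := (φ.restrictScalars K).toLinearMap
  have hf : ∀ (r : PathAlgebra K V) (m : (T i).carrier), r • f m = f (r • m) :=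
    fun r m => (φ.map_smul r m).symm
  have hi := map_subpathSpan f (fun c y _ => hf _ _) (hT i)
  rw [map_sub, f.map_smul, ← hf, ← hf] at hi
  have hinj : Function.Injective f := φ.injective
  refine hij (Subtype.ext ((T j).isTower.coeff_unique (x' := f (T i).top) ?_ ?_ u α hu (hT j)
    hi no)).symm
  · rw [hf, (T i).isTower.idem]
  · rw [hf]
    exact fun h0 => (T i).isTower.ne_zero (hinj (h0.trans (map_zero f).symm))

end TowerOperations

section Expansions

variable {K : Type u} [Field K] {V : Type v} [Fintype V] [Quiver.{w} V]
variable {M : Type x} [AddCommGroup M] [Module (PathAlgebra K V) M] {a b : V}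

theorem vertexElt_smul_pathElt_smul {c : V} (y : Path a c) (x : M) :
    vertexElt K c • pathElt K y • x = pathElt K y • x := by
  rw [smul_smul, vertexElt_mul_pathElt]

variable [Module K M] [IsScalarTower K (PathAlgebra K V) M] {x : M} {p : Path a b}

/-- The expansion of an element of the `n`-th layer along the right subpaths of the mast. -/
theorem IsTower.exists_sub_smul_mem_subpathSpan (h : IsTower (K := K) x p) {n : ℕ}
    (hn : n ≤ p.length) {m : M} (hm : m ∈ pathFiltration K V M n) :
    ∃ k : K, m - k • pathElt K p • x ∈ subpathSpan K x p n := by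
  obtain ⟨i, hi⟩ := Nat.exists_eq_add_of_le hn
  induction i generalizing n m with
  | zero =>
    have hn' : n = p.length := by omega
    subst hn'
    obtain ⟨k, hk⟩ := h.exists_sub_smul_pathElt_mem ⟨Path.nil, rfl⟩ hm
    rw [h.pathFiltration_eq_bot le_rfl, Submodule.mem_bot] at hk
    exact ⟨k, by rw [hk]; exact zero_mem _⟩
  | succ i ih =>
    obtain ⟨c, y, hy, hyn⟩ := exists_isRightSubpath p hn
    obtain ⟨l, hl⟩ := h.exists_sub_smul_pathElt_mem hy (hyn ▸ hm)
    obtain ⟨k, hk⟩ := ih (n := n + 1) (by omega) (hyn ▸ hl) (by omega)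
    refine ⟨k, ?_⟩
    have h1 : pathElt K y • x ∈ subpathSpan K x p n :=
      Submodule.subset_span ⟨c, y, hy, hyn.ge, by omega, rfl⟩
    have h2 : subpathSpan K x p (n + 1) ≤ subpathSpan K x p n := by
      refine Submodule.span_mono ?_
      rintro _ ⟨e, z, hz, h1, h2, rfl⟩
      exact ⟨e, z, hz, by omega, h2, rfl⟩
    have := add_mem (h2 hk) (Submodule.smul_mem _ l h1)
    rwa [show m - l • pathElt K y • x - k • pathElt K p • x + l • pathElt K y • x =
      m - k • pathElt K p • x by abel] at this

/-- A homogeneous element of a layer supported at another vertex lies in the next layer. -/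
theorem IsTower.mem_succ_of_ne (h : IsTower (K := K) x p) {c j : V} {y : Path a c}
    (hy : IsRightSubpath y p) (hj : j ≠ c) {m : M} (hm : vertexElt K j • m = m)
    (hmem : m ∈ pathFiltration K V M y.length) : m ∈ pathFiltration K V M (y.length + 1) := by
  obtain ⟨k, hk⟩ := h.exists_sub_smul_pathElt_mem hy hmem
  have := Submodule.smul_mem _ (vertexElt K j) hk
  rwa [smul_sub, hm, smul_comm, ← vertexElt_mul_pathElt K y, mul_smul, smul_smul,
    vertexElt_mul_of_ne K hj, zero_smul, smul_zero, sub_zero] at this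

end Expansions

section TwoLoops

variable {K : Type u} [Field K] {V : Type v} [Fintype V] [Quiver.{w} V]
variable {I : Ideal (PathAlgebra K V)}

variable {c d : V} {l : c ⟶ c} {α : c ⟶ d} {m : d ⟶ d}

/-- For a mast of the form `c → c → d → d`, a homogeneous element of positive degree at `c` is a
multiple of the second basis element. -/
theorem TowerModule.exists_eq_smul_loop
    (T : TowerModule I ((((Path.nil : Path c c).cons l).cons α).cons m)) (hcd : c ≠ d)
    {z : T.carrier} (hz : vertexElt K c • z = z) (hz1 : z ∈ pathFiltration K V T.carrier 1) :
    ∃ k : K, z = k • arrowElt K l • T.top := by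
  have h1 : IsRightSubpath ((Path.nil : Path c c).cons l)
      ((((Path.nil : Path c c).cons l).cons α).cons m) :=
    ⟨((Path.nil : Path c c).cons α).cons m, rfl⟩
  have h2 : IsRightSubpath (((Path.nil : Path c c).cons l).cons α)
      ((((Path.nil : Path c c).cons l).cons α).cons m) := ⟨(Path.nil : Path d d).cons m, rfl⟩
  obtain ⟨k, hk⟩ := T.isTower.exists_sub_smul_pathElt_mem h1 hz1
  have hk' : vertexElt K c • (z - k • pathElt K ((Path.nil : Path c c).cons l) • T.top) =
      z - k • pathElt K ((Path.nil : Path c c).cons l) • T.top := by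
    rw [smul_sub, hz, smul_comm, vertexElt_smul_pathElt_smul]
  have h3 := T.isTower.mem_succ_of_ne h2 hcd hk' hk
  have h4 := T.isTower.mem_succ_of_ne ⟨Path.nil, rfl⟩ hcd hk' h3
  rw [T.isTower.pathFiltration_eq_bot le_rfl, Submodule.mem_bot, sub_eq_zero, pathElt_single]
    at h4
  exact ⟨k, h4⟩

/-- The top element of a module with mast `c → c → d → d` can be chosen such that the arrow from
`c` to `d` sends it into the socle. -/
theorem TowerModule.exists_normalized
    (T : TowerModule I ((((Path.nil : Path c c).cons l).cons α).cons m)) (hcd : c ≠ d) :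
    ∃ (T' : TowerModule I ((((Path.nil : Path c c).cons l).cons α).cons m)) (k : K),
      arrowElt K α • T'.top =
        k • pathElt K ((((Path.nil : Path c c).cons l).cons α).cons m) • T'.top := by
  set q := (((Path.nil : Path c c).cons l).cons α).cons m with hq
  have h1 : IsRightSubpath ((Path.nil : Path c c).cons l) q :=
    ⟨((Path.nil : Path c c).cons α).cons m, rfl⟩
  have h2 : IsRightSubpath (((Path.nil : Path c c).cons l).cons α) q :=
    ⟨(Path.nil : Path d d).cons m, rfl⟩
  have hα : vertexElt K d • arrowElt K α • T.top = arrowElt K α • T.top := by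
    rw [smul_smul, vertexElt_mul_arrowElt]
  have hm2 := T.isTower.mem_succ_of_ne h1 hcd.symm hα
    (smul_mem_pathFiltration (arrowElt_mem_pathSpan α) _)
  obtain ⟨k₁, hk₁⟩ := T.isTower.exists_sub_smul_pathElt_mem h2 hm2
  obtain ⟨k₂, hk₂⟩ := T.isTower.exists_sub_smul_pathElt_mem (y := q) ⟨Path.nil, rfl⟩ hk₁
  rw [T.isTower.pathFiltration_eq_bot le_rfl, Submodule.mem_bot, sub_eq_zero, sub_eq_iff_eq_add]
    at hk₂
  have hl : pathElt K q • arrowElt K l • T.top = 0 := by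
    rw [smul_smul]
    exact T.isTower.kill _ (mul_mem_pathSpan (pathElt_mem_pathSpan K q le_rfl)
      (arrowElt_mem_pathSpan l)) _
  have hqx : pathElt K q • (T.top - k₁ • arrowElt K l • T.top) = pathElt K q • T.top := by
    rw [smul_sub, smul_comm, hl, smul_zero, sub_zero]
  have hαl : (arrowElt K α * arrowElt K l) • T.top =
      pathElt K (((Path.nil : Path c c).cons l).cons α) • T.top := by
    rw [pathElt_cons, pathElt_single]
  refine ⟨{ carrier := T.carrier
            torsion := T.torsion
            top := T.top - k₁ • arrowElt K l • T.top
            isTower := ⟨T.isTower.chain, ?_, ?_, T.isTower.kill⟩ }, k₂, ?_⟩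
  · rw [smul_sub, T.isTower.idem, smul_comm, smul_smul, vertexElt_mul_arrowElt]
  · rw [hqx]
    exact T.isTower.ne_zero
  · change arrowElt K α • (T.top - k₁ • arrowElt K l • T.top) =
      k₂ • pathElt K q • (T.top - k₁ • arrowElt K l • T.top)
    rw [hqx, smul_sub, hk₂, smul_comm (arrowElt K α) k₁, smul_smul (arrowElt K α), hαl,
      add_sub_cancel_right]

end TwoLoops

section ParallelArrows

variable {K : Type u} [Field K] {V : Type v} [Fintype V] [Quiver.{w} V]
variable {I : Ideal (PathAlgebra K V)} [I.IsTwoSided]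

/-- An arrow parallel to a mast, but not contained in it, forces the mast to return to its starting
vertex. -/
theorem exists_return_of_parallel [Infinite K] (hI : IsAdmissible I)
    (hfin : FiniteUniserialType I) {c d : V} {q : Path c d} (T : TowerModule I q)
    (hq : 1 ≤ q.length) (α : c ⟶ d) (hα : ¬ IsRightSubpath ((Path.nil : Path c c).cons α) q) :
    ∃ y : Path c c, IsRightSubpath y q ∧ 1 ≤ y.length ∧ y.length ≤ q.length - 1 := by
  have hmem : arrowElt K α • T.top ∈ pathFiltration K V T.carrier 1 :=
    smul_mem_pathFiltration (arrowElt_mem_pathSpan α) _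
  obtain ⟨k₀, hk₀⟩ := T.isTower.exists_sub_smul_mem_subpathSpan hq hmem
  refine exists_return_of_infinite hfin (Path.nil : Path c c) α (by rw [Path.length_nil]; omega)
    (S := Set.univ) Set.infinite_univ fun k _ => ?_
  obtain ⟨T', f, htop, hsub, hf⟩ := T.exists_shear hI hq α hα (k - k₀)
  refine ⟨T', ?_⟩
  have h := map_subpathSpan f (fun c y hy => hsub c y hy _) hk₀
  rw [pathElt_single, htop, hf, hsub _ q ⟨Path.nil, rfl⟩, ← f.map_smul k, ← map_sub]
  have e : arrowElt K α • T.top + (k - k₀) • pathElt K q • T.top - k • pathElt K q • T.top =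
      arrowElt K α • T.top - k₀ • pathElt K q • T.top := by
    rw [sub_smul]; abel
  rw [e]
  exact h

/-- There is no other arrow parallel to an arrow of a mast. -/
theorem eq_of_parallel [Infinite K] (hI : IsAdmissible I) (hfin : FiniteUniserialType I)
    {c d : V} {β : c ⟶ d} (T : TowerModule I ((Path.nil : Path c c).cons β)) (α : c ⟶ d) :
    α = β := by
  by_contra hne
  obtain ⟨y, -, h1, h2⟩ := exists_return_of_parallel hI hfin T (by simp) α fun h => by
    have := h.eq_of_length_eq ⟨Path.nil, rfl⟩ rfl
    simp only [Sigma.mk.injEq, heq_eq_eq, true_and, Path.cons.injEq] at this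
    exact hne this
  change y.length ≤ 0 at h2
  omega

theorem false_of_triangle [Infinite K] (hI : IsAdmissible I) (hfin : FiniteUniserialType I)
    {c d e : V} {β : c ⟶ e} {γ : e ⟶ d}
    (T : TowerModule I (((Path.nil : Path c c).cons β).cons γ)) (hce : c ≠ e) (hed : e ≠ d)
    (α : c ⟶ d) : False := by
  have hβ : IsRightSubpath ((Path.nil : Path c c).cons β)
      (((Path.nil : Path c c).cons β).cons γ) := ⟨(Path.nil : Path e e).cons γ, rfl⟩
  obtain ⟨y, hy, h1, h2⟩ := exists_return_of_parallel hI hfin T (by simp) α fun h => by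
    have := h.eq_of_length_eq hβ rfl
    exact hed (congrArg Sigma.fst this).symm
  change y.length ≤ 1 at h2
  exact hce (congrArg Sigma.fst (hy.eq_of_length_eq hβ (le_antisymm h2 h1)))

/-- A mast does not contain a segment of the form `c → c → d → d`. -/
theorem false_of_two_loops [Infinite K] (hI : IsAdmissible I) (hfin : FiniteUniserialType I)
    {c d : V} {l : c ⟶ c} {α : c ⟶ d} {m : d ⟶ d}
    (T₀ : TowerModule I ((((Path.nil : Path c c).cons l).cons α).cons m)) (hcd : c ≠ d) :
    False := by
  set q := (((Path.nil : Path c c).cons l).cons α).cons m with hq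
  obtain ⟨T, k₀, hk₀⟩ : ∃ (T : TowerModule I q) (k : K),
      arrowElt K α • T.top = k • pathElt K q • T.top := T₀.exists_normalized hcd
  have h1 : IsRightSubpath ((Path.nil : Path c c).cons l) q :=
    ⟨((Path.nil : Path c c).cons α).cons m, rfl⟩
  have h2 : IsRightSubpath (((Path.nil : Path c c).cons l).cons α) q :=
    ⟨(Path.nil : Path d d).cons m, rfl⟩
  have hα : ¬ IsRightSubpath ((Path.nil : Path c c).cons α) q := fun h =>
    hcd (congrArg Sigma.fst (h.eq_of_length_eq h1 rfl)).symm
  have fam : ∀ k : K, ∃ T' : TowerModule I q,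
      arrowElt K α • T'.top =
        k • pathElt K q • T'.top := by
    intro k
    obtain ⟨T', f, htop, hsub, hf⟩ := T.exists_shear hI (by simp [hq]) α hα (k - k₀)
    refine ⟨T', ?_⟩
    rw [htop, hf, hsub _ _ ⟨Path.nil, rfl⟩, hk₀, ← add_smul, add_sub_cancel, f.map_smul]
  choose S hS using fam
  obtain ⟨i, j, hij, ⟨φ⟩⟩ := exists_linearEquiv_of_infinite hfin S
  have hφ : ∀ (k : K) (z : (S i).carrier), φ (k • z) = k • φ z :=
    fun k z => (φ.restrictScalars K).map_smul k z
  set x' := φ (S i).top with hx'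
  have hc : vertexElt K c • x' = x' := by rw [hx', ← φ.map_smul, (S i).isTower.idem]
  have hne : pathElt K q • x' ≠ 0 := by
    rw [hx', ← φ.map_smul]
    exact fun h0 => (S i).isTower.ne_zero (φ.injective (h0.trans (map_zero φ).symm))
  have hi : arrowElt K α • x' = i • pathElt K q • x' := by
    rw [hx', ← φ.map_smul, ← φ.map_smul, hS, hφ]
  have tow := (S j).isTower
  obtain ⟨t, ht⟩ := tow.exists_sub_smul_pathElt_mem (y := Path.nil) ⟨q, by simp⟩
    (mem_pathFiltration_zero x')
  rw [pathElt_nil, tow.idem, Path.length_nil, zero_add] at ht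
  obtain ⟨t', ht'⟩ := (S j).exists_eq_smul_loop hcd (by rw [smul_sub, hc, smul_comm, tow.idem]) ht
  rw [sub_eq_iff_eq_add] at ht'
  have hl : pathElt K q • arrowElt K l • (S j).top = 0 := by
    rw [smul_smul]
    exact tow.kill _ (mul_mem_pathSpan (pathElt_mem_pathSpan K q le_rfl)
      (arrowElt_mem_pathSpan l)) _
  have hqx : pathElt K q • x' = t • pathElt K q • (S j).top := by
    rw [ht', smul_add, smul_comm, hl, smul_zero, zero_add, smul_comm]
  have ht0 : t ≠ 0 := by
    rintro rfl
    rw [zero_smul] at hqx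
    exact hne hqx
  have hαl : arrowElt K α • arrowElt K l • (S j).top =
      pathElt K (((Path.nil : Path c c).cons l).cons α) • (S j).top := by
    rw [pathElt_cons, pathElt_single, mul_smul]
  rw [hqx, ht', smul_add, smul_comm, smul_comm _ t, hS j, hαl] at hi
  have key : t' • pathElt K (((Path.nil : Path c c).cons l).cons α) • (S j).top =
      (t * (i - j)) • pathElt K q • (S j).top := by
    rw [← eq_sub_iff_add_eq] at hi
    rw [hi]
    generalize pathElt K q • (S j).top = z
    module
  have ht0' : t' = 0 := by
    by_contra h
    refine tow.pathElt_smul_notMem h2 (mem_of_smul_mem_tower h ?_)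
    rw [key]
    exact Submodule.smul_of_tower_mem _ _ (IsTower.pathElt_smul_mem q _)
  rw [ht0', zero_smul] at key
  exact smul_ne_zero (mul_ne_zero ht0 (sub_ne_zero.2 hij)) tow.ne_zero key.symm

end ParallelArrows

/-! ### Slack variables -/

section Slack

variable {K : Type u} [Field K] {V : Type v} [Fintype V] [Quiver.{w} V]
variable {I : Ideal (PathAlgebra K V)} [I.IsTwoSided]

theorem infinite_of_transcendental {a b : V} {p : Path a b} {δ : Detour p} {v : δ.family}
    (h : Transcendental K (coordVar I δ v)) :
    ((fun k : DetourVar p → K => k ⟨δ, v⟩) '' uniserialVariety I p).Infinite := by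
  intro hS
  let g : Polynomial K := ∏ t ∈ hS.toFinset, (Polynomial.X - Polynomial.C t)
  refine h ⟨g, (Polynomial.monic_prod_of_monic _ _ fun t _ => Polynomial.monic_X_sub_C t).ne_zero,
    ?_⟩
  have e : Polynomial.aeval (coordVar I δ v) g = Ideal.Quotient.mkₐ K
      (MvPolynomial.vanishingIdeal K (uniserialVariety I p))
      (Polynomial.aeval (MvPolynomial.X ⟨δ, v⟩) g) := by
    rw [← Polynomial.aeval_algHom_apply]
    rfl
  rw [e, Ideal.Quotient.mkₐ_eq_mk, Ideal.Quotient.eq_zero_iff_mem,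
    MvPolynomial.mem_vanishingIdeal_iff]
  intro k hk
  rw [← Polynomial.aeval_algHom_apply, MvPolynomial.aeval_X, map_prod]
  refine Finset.prod_eq_zero (hS.mem_toFinset.2 ⟨k, hk, rfl⟩) ?_
  simp

/-- A slack variable attached to a detour `(α,u)` and the right subpath `v` forces the segment of
the mast between any vertex above the end of `u` and the end of `v` to return early. -/
theorem exists_return_of_slack (hI : IsAdmissible I) (hfin : FiniteUniserialType I)
    {a b c : V} {p : Path a b} {δ : Detour p} {v : δ.family}
    (h : Transcendental K (coordVar I δ v)) {r : Path a c} {y : Path c δ.c} {z : Path δ.c δ.d}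
    {s : Path δ.d b} (hp : p = r.comp ((y.comp z).comp s)) (hu : δ.u = r.comp y)
    (hv : v.1 = r.comp (y.comp z)) :
    ∃ t : Path c c, IsRightSubpath t (y.comp z) ∧ 1 ≤ t.length ∧ t.length ≤ z.length - 1 := by
  have hvl : v.1.length = r.length + (y.length + z.length) := by
    rw [hv, Path.length_comp, Path.length_comp]
  have hul : δ.u.length = r.length + y.length := by rw [hu, Path.length_comp]
  have hlt := v.2.2
  have hz : (y.comp z).length - y.length - 1 = z.length - 1 := by
    rw [Path.length_comp]; omega
  rw [← hz]
  refine exists_return_of_infinite hfin y δ.α (by rw [Path.length_comp]; omega)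
    (infinite_of_transcendental h) ?_
  rintro _ ⟨k, ⟨U, _, _, hU, x, hx, hk⟩, rfl⟩
  have : ∃ T : TowerModule I p, pathElt K (δ.u.cons δ.α) • T.top =
      ∑ᶠ v : δ.family, (k ⟨δ, v⟩) • pathElt K v.1 • T.top := by
    refine ⟨TowerModule.ofMast hI hU hx, ?_⟩
    refine (hk δ).trans (finsum_congr fun v => ?_)
    change (algebraMap K (PathAlgebra K V) (k ⟨δ, v⟩) * pathElt K v.1) •
      (TowerModule.ofMast hI hU hx).top = _
    rw [← Algebra.smul_def, smul_assoc]
  obtain ⟨T, hT⟩ := this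
  clear hk hx hU
  change ∃ T : TowerModule I (y.comp z), pathElt K (y.cons δ.α) • T.top -
    k ⟨δ, v⟩ • pathElt K (y.comp z) • T.top ∈ subpathSpan K T.top (y.comp z) (y.length + 1)
  have hmem : pathElt K (δ.u.cons δ.α) • T.top - k ⟨δ, v⟩ • pathElt K v.1 • T.top ∈
      Submodule.span K {m | ∃ w : δ.family, w ≠ v ∧ m = pathElt K w.1 • T.top} := by
    have : Fintype δ.family := δ.family_finite.fintype
    classical
    rw [hT, finsum_eq_sum_of_fintype, ← Finset.add_sum_erase _ _ (Finset.mem_univ v),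
      add_sub_cancel_left]
    refine Submodule.sum_mem _ fun w hw => Submodule.smul_mem _ _ (Submodule.subset_span ?_)
    exact ⟨w, (Finset.mem_erase.1 hw).1, rfl⟩
  generalize k ⟨δ, v⟩ = κ at hmem ⊢
  obtain ⟨T', hT'⟩ := T.exists_segment hp
  refine ⟨T', ?_⟩
  have key : ∀ g ∈ Submodule.span K {m | ∃ w : δ.family, w ≠ v ∧ m = pathElt K w.1 • T.top},
      ∃ g' : PathAlgebra K V, g - g' • pathElt K r • T.top ∈
        pathFiltration K V T.carrier (r.length + (y.comp z).length + 1) ∧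
        g' • T'.top ∈ subpathSpan K T'.top (y.comp z) (y.length + 1) := by
    intro g hg
    refine Submodule.span_induction (p := fun g _ => ∃ g' : PathAlgebra K V,
      g - g' • pathElt K r • T.top ∈
        pathFiltration K V T.carrier (r.length + (y.comp z).length + 1) ∧
        g' • T'.top ∈ subpathSpan K T'.top (y.comp z) (y.length + 1)) ?_ ?_ ?_ ?_ hg
    · rintro _ ⟨w, hwv, rfl⟩
      have hwl : w.1.length ≠ v.1.length := fun e => hwv (Subtype.ext (by
        simpa using w.2.1.eq_of_length_eq v.2.1 e))
      have hw := w.2.2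
      rw [Path.length_comp]
      by_cases hlong : v.1.length < w.1.length
      · refine ⟨0, ?_, ?_⟩
        · rw [zero_smul, sub_zero]
          exact pathFiltration_anti (by omega) (IsTower.pathElt_smul_mem w.1 T.top)
        · rw [zero_smul]; exact zero_mem _
      · obtain ⟨e, t, ht, htl⟩ := exists_isRightSubpath (y.comp z) (n := w.1.length - r.length)
          (by rw [Path.length_comp]; omega)
        have hrt : IsRightSubpath (r.comp t) p := by
          obtain ⟨t', ht'⟩ := ht
          exact ⟨t'.comp s, hp.trans (by rw [ht', Path.comp_assoc, Path.comp_assoc])⟩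
        have hwt : pathElt K w.1 = pathElt K t * pathElt K r := by
          have := w.2.1.eq_of_length_eq hrt (by rw [Path.length_comp]; omega)
          rw [← pathElt_comp]
          exact congrArg (fun q : Σ c, Path a c => pathElt K q.2) this
        refine ⟨pathElt K t, ?_, ?_⟩
        · rw [hwt, mul_smul, sub_self]; exact zero_mem _
        · exact Submodule.subset_span ⟨e, t, ht, by omega, by rw [Path.length_comp]; omega, rfl⟩
    · exact ⟨0, by rw [zero_smul, sub_zero]; exact zero_mem _, by rw [zero_smul]; exact zero_mem _⟩
    · rintro g₁ g₂ _ _ ⟨g₁', h₁, h₁'⟩ ⟨g₂', h₂, h₂'⟩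
      refine ⟨g₁' + g₂', ?_, ?_⟩
      · rw [add_smul, add_sub_add_comm]; exact add_mem h₁ h₂
      · rw [add_smul]; exact add_mem h₁' h₂'
    · rintro l g _ ⟨g', h, h'⟩
      refine ⟨l • g', ?_, ?_⟩
      · rw [smul_assoc, ← smul_sub]; exact Submodule.smul_of_tower_mem _ l h
      · rw [smul_assoc]; exact Submodule.smul_mem _ l h'
  obtain ⟨g', hg', hg''⟩ := key _ hmem
  have e : (pathElt K (y.cons δ.α) - κ • pathElt K (y.comp z) - g') • T'.top = 0 := by
    refine hT' _ ?_
    rw [sub_smul, sub_smul, smul_assoc, smul_smul _ (pathElt K r), smul_smul _ (pathElt K r),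
      ← pathElt_comp, ← pathElt_comp, Path.comp_cons, ← hu, ← hv]
    exact hg'
  rw [sub_smul, sub_eq_zero, sub_smul, smul_assoc] at e
  rw [e]
  exact hg''

end Slack

/-! ### Graphs of short paths -/

section Shapes

variable {V : Type v} [Quiver.{w} V]

/-- The nodes passed by a path, with their layers. -/
def pathNodes {a b : V} (p : Path a b) : Set (ℕ × V) :=
  {x | ∃ (c : V) (q : Path a c), IsRightSubpath q p ∧ x = (q.length, c)}

/-- The edges of a path, with their layers. -/
def pathEdges {a b : V} (p : Path a b) : Set (ℕ × ℕ × (Σ i j : V, (i ⟶ j))) :=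
  {x | ∃ (c d : V) (q : Path a c) (β : c ⟶ d), IsRightSubpath (q.cons β) p ∧
    x = (q.length, q.length + 1, ⟨c, d, β⟩)}

theorem IsRightSubpath.refl {a b : V} (p : Path a b) : IsRightSubpath p p := ⟨Path.nil, rfl⟩

theorem IsRightSubpath.cons {a b c d : V} {q : Path a c} {p : Path a b}
    (h : IsRightSubpath q p) (β : b ⟶ d) : IsRightSubpath q (p.cons β) := by
  obtain ⟨s, rfl⟩ := h
  exact ⟨s.cons β, rfl⟩

theorem isRightSubpath_cons_cases {a b c d : V} {q : Path a c} {p : Path a b} {β : b ⟶ d}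
    (h : IsRightSubpath q (p.cons β)) :
    IsRightSubpath q p ∨ (⟨c, q⟩ : Σ c, Path a c) = ⟨d, p.cons β⟩ := by
  by_cases hl : q.length = p.length + 1
  · exact Or.inr (h.eq_of_length_eq (IsRightSubpath.refl _) hl)
  · obtain ⟨s, hs⟩ := h
    cases s with
    | nil =>
      have := congrArg Path.length hs
      simp at this
      omega
    | cons s γ =>
      simp only [Path.comp_cons, Path.cons.injEq] at hs
      obtain ⟨rfl, hs, -⟩ := hs
      exact Or.inl ⟨s, eq_of_heq hs⟩

theorem isRightSubpath_nil_iff {a c : V} {q : Path a c} :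
    IsRightSubpath q (Path.nil : Path a a) ↔ (⟨c, q⟩ : Σ c, Path a c) = ⟨a, Path.nil⟩ := by
  constructor
  · intro h
    have := h.length_le
    exact h.eq_of_length_eq (IsRightSubpath.refl _) (by simpa using this)
  · intro h
    cases h
    exact IsRightSubpath.refl _

@[simp] theorem pathNodes_nil (a : V) : pathNodes (Path.nil : Path a a) = {(0, a)} := by
  ext x
  simp only [pathNodes, Set.mem_ofPred_eq, Set.mem_singleton_iff, isRightSubpath_nil_iff]
  constructor
  · rintro ⟨c, q, h, rfl⟩
    cases h
    rfl
  · rintro rfl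
    exact ⟨a, Path.nil, rfl, rfl⟩

@[simp] theorem pathNodes_cons {a b d : V} (p : Path a b) (β : b ⟶ d) :
    pathNodes (p.cons β) = insert (p.length + 1, d) (pathNodes p) := by
  ext x
  constructor
  · rintro ⟨c, q, h, rfl⟩
    rcases isRightSubpath_cons_cases h with h | h
    · exact Or.inr ⟨c, q, h, rfl⟩
    · cases h
      exact Or.inl rfl
  · rintro (rfl | ⟨c, q, h, rfl⟩)
    · exact ⟨d, p.cons β, IsRightSubpath.refl _, rfl⟩
    · exact ⟨c, q, h.cons β, rfl⟩

@[simp] theorem pathEdges_nil (a : V) : pathEdges (Path.nil : Path a a) = ∅ := by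
  refine Set.eq_empty_iff_forall_notMem.2 ?_
  rintro _ ⟨c, d, q, β, h, -⟩
  have := h.length_le
  simp at this

@[simp] theorem pathEdges_cons {a b d : V} (p : Path a b) (β : b ⟶ d) :
    pathEdges (p.cons β) = insert (p.length, p.length + 1, ⟨b, d, β⟩) (pathEdges p) := by
  ext x
  constructor
  · rintro ⟨c, e, q, γ, h, rfl⟩
    rcases isRightSubpath_cons_cases h with h | h
    · exact Or.inr ⟨c, e, q, γ, h, rfl⟩
    · cases h
      exact Or.inl rfl
  · rintro (rfl | ⟨c, e, q, γ, h, rfl⟩)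
    · exact ⟨b, d, p, β, IsRightSubpath.refl _, rfl⟩
    · exact ⟨c, e, q, γ, h.cons β, rfl⟩

/-- The combinatorial core of the classification: a path `p = s w u` of length at most four, with an
arrow `α` parallel to `w`, subject to the restrictions coming from finite uniserial type, is one of
the listed shapes. -/
theorem exists_listedShape {a b c d : V} (u : Path a c) (α : c ⟶ d) (w : Path c d) (s : Path d b)
    {p : Path a b} (hp : p = (u.comp w).comp s) (hu : 0 < u.length) (hw : 0 < w.length)
    (hlen : p.length ≤ 4) (hα : ¬ IsRightSubpath (u.cons α) p)
    (parallel : ∀ {e f : V} {g : Path a e} {β : e ⟶ f}, IsRightSubpath (g.cons β) p →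
      ∀ β' : e ⟶ f, β' = β)
    (triangle : ∀ {e f g : V} {h : Path a e} {β : e ⟶ f} {γ : f ⟶ g},
      IsRightSubpath ((h.cons β).cons γ) p → e ≠ f → f ≠ g → (e ⟶ g) → False)
    (loops : ∀ {e f : V} {h : Path a e} {l : e ⟶ e} {β : e ⟶ f} {m : f ⟶ f},
      IsRightSubpath (((h.cons l).cons β).cons m) p → e ≠ f → False)
    (return_ : ∀ {e : V} (r : Path a e) (y : Path e c), u = r.comp y →
      ∃ n, (n, e) ∈ pathNodes (y.comp w) ∧ 1 ≤ n ∧ n ≤ w.length - 1)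
    {n : ℕ} (hn : (n, d) ∈ pathNodes p) (hun : u.length < n) :
    ∃ H : LayeredGraph V, IsListedShape H ∧ pathNodes p ⊆ H.nodes ∧
      insert (u.length, n, ⟨c, d, α⟩) (pathEdges p) ⊆ H.edges := by
  subst hp
  simp only [Path.length_comp] at hlen
  cases w with
  | nil => simp at hw
  | cons w β =>
  rename_i g
  cases w with
  | nil =>
    cases parallel (g := u) (β := β) ⟨s, rfl⟩ α
    exact absurd ⟨s, rfl⟩ hα
  | cons w ε =>
  rename_i f
  cases w with
  | nil =>
    have hgd : g ≠ d := by
      rintro rfl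
      cases parallel (g := u) (β := ε)
        ⟨((Path.nil : Path g g).cons β).comp s, by rw [← Path.comp_assoc]; rfl⟩ α
      exact hα ⟨((Path.nil : Path g g).cons β).comp s, by rw [← Path.comp_assoc]; rfl⟩
    have hcg : c = g := by
      obtain ⟨m, hm, hm1, hm2⟩ := return_ u Path.nil rfl
      simp at hm hm2
      grind
    subst hcg
    obtain rfl : α = β := parallel (g := u.cons ε) ⟨s, by simp⟩ α
    cases u with
    | nil => simp at hu
    | cons u δ =>
    rename_i e
    cases u with
    | nil =>
      have hac : a = c := by
        obtain ⟨m, hm, hm1, hm2⟩ := return_ Path.nil (Path.nil.cons δ) rfl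
        simp at hm hm2
        grind
      subst hac
      obtain rfl : ε = δ := parallel (g := Path.nil)
        ⟨(((Path.nil : Path a a).cons ε).cons α).comp s, by rw [← Path.comp_assoc]⟩ ε
      cases s with
      | nil =>
        refine ⟨_, Or.inl ⟨a, b, ε, α, hgd, rfl⟩, ?_⟩
        simp [shapeLoopTwoShort, Set.insert_subset_iff] at hn hun ⊢
        grind
      | cons s m =>
        cases s with
        | nil =>
          by_cases hdb : d = b
          · subst hdb
            exact (loops (h := Path.nil.cons ε) ⟨Path.nil, rfl⟩ hgd).elim
          by_cases hab : a = b
          · subst hab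
            exact (triangle (h := (Path.nil.cons ε).cons ε) ⟨Path.nil, rfl⟩ hgd hdb ε).elim
          refine ⟨_, Or.inr (Or.inl ⟨a, d, b, ε, α, m, hgd, hab, hdb, rfl⟩), ?_⟩
          simp [shapeLoopTwo, Set.insert_subset_iff] at hn hun ⊢
          grind
        | cons s m' => simp at hlen; omega
    | cons u δ' =>
      rename_i e'
      obtain ⟨hu0, hs0⟩ : u.length = 0 ∧ s.length = 0 := by simp at hlen; omega
      cases u with
      | cons u δ'' => simp at hu0
      | nil =>
      cases s with
      | cons s m => simp at hs0
      | nil =>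
      have hec : e = c := by
        obtain ⟨m, hm, hm1, hm2⟩ := return_ (Path.nil.cons δ') (Path.nil.cons δ) rfl
        simp at hm hm2
        grind
      subst hec
      have hae : a = e := by
        obtain ⟨m, hm, hm1, hm2⟩ := return_ Path.nil ((Path.nil.cons δ').cons δ) rfl
        simp at hm hm2
        grind
      subst hae
      obtain rfl : δ' = δ := parallel (g := Path.nil.cons δ')
        ⟨((Path.nil : Path a a).cons ε).cons α, rfl⟩ δ'
      obtain rfl : δ' = ε := parallel (g := (Path.nil.cons δ').cons δ')
        ⟨(Path.nil : Path a a).cons α, rfl⟩ δ'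
      refine ⟨_, Or.inr (Or.inr (Or.inl ⟨a, b, δ', α, hgd, rfl⟩)), ?_⟩
      simp [shapeLoopThree, Set.insert_subset_iff] at hn hun ⊢
      grind
  | cons w γ =>
    rename_i k
    obtain ⟨hu1, hw0, hs0⟩ : u.length = 1 ∧ w.length = 0 ∧ s.length = 0 := by
      simp at hlen; omega
    cases s with
    | cons s m => simp at hs0
    | nil =>
    cases w with
    | cons w m => simp at hw0
    | nil =>
    cases u with
    | nil => simp at hu
    | cons u δ =>
    rename_i e
    cases u with
    | cons u δ' => simp at hu1
    | nil =>
    have hfd : f ≠ b := by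
      rintro rfl
      cases parallel (g := Path.nil.cons δ) (β := γ)
        ⟨((Path.nil : Quiver.Path _ _).cons ε).cons β, rfl⟩ α
      exact hα ⟨((Path.nil : Quiver.Path _ _).cons ε).cons β, rfl⟩
    have h1 : c = f ∨ c = g := by
      obtain ⟨m, hm, hm1, hm2⟩ := return_ (Path.nil.cons δ) Path.nil rfl
      simp at hm hm2
      grind
    have h2 : a = c ∨ a = f := by
      obtain ⟨m, hm, hm1, hm2⟩ := return_ Path.nil (Path.nil.cons δ) rfl
      simp at hm hm2
      grind
    by_cases hcf : c = f
    · subst hcf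
      obtain rfl : a = c := by simpa using h2
      obtain rfl : δ = γ := parallel (g := Path.nil.cons δ)
        ⟨((Path.nil : Path a a).cons ε).cons β, rfl⟩ δ
      by_cases hag : a = g
      · subst hag
        obtain rfl : δ = ε := parallel (g := (Path.nil.cons δ).cons δ)
          ⟨(Path.nil : Path a a).cons β, rfl⟩ δ
        obtain rfl : α = β := parallel (g := ((Path.nil.cons δ).cons δ).cons δ)
          ⟨Path.nil, rfl⟩ α
        refine ⟨_, Or.inr (Or.inr (Or.inl ⟨a, b, δ, α, hfd, rfl⟩)), ?_⟩
        simp [shapeLoopThree, Set.insert_subset_iff] at hn hun ⊢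
        grind
      · by_cases hgd : g = b
        · subst hgd
          exact (loops (h := Path.nil.cons δ) ⟨Path.nil, rfl⟩ hag).elim
        · exact (triangle (h := (Path.nil.cons δ).cons δ) ⟨Path.nil, rfl⟩ hag hgd α).elim
    · obtain rfl : c = g := h1.resolve_left hcf
      obtain rfl : α = β := parallel (g := ((Path.nil.cons δ).cons γ).cons ε) ⟨Path.nil, rfl⟩ α
      have noloop : (c ⟶ c) → False := triangle (h := Path.nil.cons δ)
        ⟨(Path.nil : Path c c).cons α, rfl⟩ hcf (Ne.symm hcf)
      rcases h2 with rfl | rfl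
      · exact (noloop δ).elim
      · obtain rfl : δ = ε := parallel (g := (Path.nil.cons δ).cons γ)
          ⟨(Path.nil : Path c c).cons α, rfl⟩ δ
        have hcd : c ≠ b := by
          rintro rfl
          exact noloop α
        refine ⟨_, Or.inr (Or.inr (Or.inr ⟨a, c, b, δ, γ, α, Ne.symm hcf, hfd, hcd, rfl⟩)), ?_⟩
        simp [shapeTwoCycle, Set.insert_subset_iff] at hn hun ⊢
        grind

end Shapes

theorem theorem7p2 {K : Type u} [Field K] [Infinite K]
    {V : Type v} [Fintype V] [Quiver.{w} V] [∀ i j : V, Finite (i ⟶ j)]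
    (I : Ideal (PathAlgebra K V)) [I.IsTwoSided] (hI : IsAdmissible I)
    (hfin : FiniteUniserialType I)
    (U : Type max u v w) [AddCommGroup U] [Module (PathAlgebra K V ⧸ I) U]
    {a b : V} (p : Path a b) (hp : IsMastOf I U p)
    (hlen : Module.length (PathAlgebra K V ⧸ I) U ≤ 5)
    (δ : Detour p) (hδ : IsSlackHalyard I δ) (hu : 0 < δ.u.length)
    (v : δ.family) (hv : HasGraphAt I δ v) :
    ∃ H : LayeredGraph V, IsListedShape H ∧ (halyardGraph δ v).IsSubgraph H := by
  obtain ⟨U', _, _, hU', x, hx, -⟩ := hv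
  let T : TowerModule I p := TowerModule.ofMast hI hU' hx
  obtain ⟨-, v₀, hv₀⟩ := hδ
  have hlen' : p.length ≤ 4 := by
    rw [hp.2.1] at hlen
    have : ((p.length + 1 : ℕ) : ℕ∞) ≤ (5 : ℕ) := by exact_mod_cast hlen
    norm_cast at this
    omega
  obtain ⟨w, hw⟩ : ∃ w : Path δ.c δ.d, v₀.1 = δ.u.comp w := by
    obtain ⟨s, hs⟩ := v₀.2.1
    have hlt := v₀.2.2
    obtain ⟨e, w, ⟨s', hs'⟩, hwl⟩ : ∃ (e : V) (w : Path δ.c e),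
        IsRightSubpath (δ.u.comp w) p ∧ (δ.u.comp w).length = v₀.1.length := by
      obtain ⟨t, ht⟩ := δ.right
      have hl1 := congrArg Path.length ht
      have hl2 := congrArg Path.length hs
      simp only [Path.length_comp] at hl1 hl2
      obtain ⟨e, w, ⟨s', hs'⟩, hw⟩ := exists_isRightSubpath t
        (n := v₀.1.length - δ.u.length) (by omega)
      exact ⟨e, w, ⟨s', ht.trans (by rw [hs', Path.comp_assoc])⟩, by
        rw [Path.length_comp]; omega⟩
    have h := v₀.2.1.eq_of_length_eq ⟨s', hs'⟩ hwl.symm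
    obtain rfl : δ.d = e := congrArg Sigma.fst h
    exact ⟨w, by simpa using h⟩
  obtain ⟨s, hs⟩ := v₀.2.1
  rw [hw] at hs
  have hwl : 0 < w.length := by
    have := v₀.2.2
    rw [hw, Path.length_comp] at this
    omega
  refine exists_listedShape δ.u δ.α w s hs hu hwl hlen' δ.notRight ?_ ?_ ?_ ?_
    ⟨_, v.1, v.2.1, rfl⟩ v.2.2
  · rintro e f g β ⟨t, ht⟩ β'
    obtain ⟨T', -⟩ := T.exists_segment (r := g) (q := (Path.nil : Path e e).cons β) (s := t)
      (by rw [ht, ← Path.comp_assoc]; rfl)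
    exact eq_of_parallel hI hfin T' β'
  · rintro e f g h β γ ⟨t, ht⟩ hef hfg ε
    obtain ⟨T', -⟩ := T.exists_segment (r := h) (q := ((Path.nil : Path e e).cons β).cons γ)
      (s := t) (by rw [ht, ← Path.comp_assoc]; rfl)
    exact false_of_triangle hI hfin T' hef hfg ε
  · rintro e f h l β m ⟨t, ht⟩ hef
    obtain ⟨T', -⟩ := T.exists_segment (r := h)
      (q := (((Path.nil : Path e e).cons l).cons β).cons m) (s := t)
      (by rw [ht, ← Path.comp_assoc]; rfl)
    exact false_of_two_loops hI hfin T' hef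
  · intro e r y hy
    obtain ⟨t, ht, h1, h2⟩ := exists_return_of_slack hI hfin hv₀ (r := r) (y := y) (z := w)
      (s := s) (hs.trans (by rw [hy]; simp only [Path.comp_assoc])) hy
      (hw.trans (by rw [hy, Path.comp_assoc]))
    exact ⟨t.length, ⟨e, t, ht, rfl⟩, h1, h2⟩
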